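/- **Partitions.** A (two-colored) partition $p\in P^{\circ\bullet}(k,l)$ consists of a row of $k$ upper points and a row of $l$ lower points ($k,l\in\mathbb N_0=\{0,1,2,\dots\}$), each colored white ($\circ$) or black ($\bullet$), and a decomposition of these $k+l$ points into disjoint blocks. It is noncrossing if its blocks can be drawn without crossings in the strip between the two rows. The tensor product $p\otimes q$ places $p$ and $q$ side by side, the composition $pq$ places $p$ below $q$, connects, and removes the middle points (it is defined if the colors of the lower points of $q$ match those of the upper points of $p$), and the involution $p^*$ reflects $p$ at the horizontal axis. Rotating a partition means moving the leftmost (or the rightmost) point of one row to the left (respectively right) end of the other row, inverting its color and keeping its block; a rotated version of $p$ is obtained from $p$ by finitely many such rotations. Let $c(p)\in\mathbb Z$ be the number of white lower and black upper points minus the number of black lower and white upper points. A category of partitions is a set of partitions closed under tensor product, composition and involution and containing the two pair partitions in $P^{\circ\bullet}(0,2)$ colored $\circ\bullet$ and $\bullet\circ$ and the two identity partitions in $P^{\circ\bullet}(1,1)$ (one block, both points white, or both black). Write $\langle p_1,\dots,p_n\rangle$ for the smallest category of partitions containing $p_1,\dots,p_n$. **Generators.** All of them have only lower points. Let $s_\circ,s_\bullet\in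 P^{\circ\bullet}(0,1)$ be the white and the black singleton. Let $\mathrm{pos}_d\in P^{\circ\bullet}(0,2d+2)$ be the partition whose points are, from left to right, $d$ white singleton blocks, a white point $a$, $d$ black singleton blocks, and a black point $a'$, where $\{a,a'\}$ is a block. Let $f\in P^{\circ\bullet}(0,4)$ be the partition with a single block colored $\circ\bullet\circ\bullet$. **The sets.** Let $k,d\in\mathbb N_0$ be such that $d$ divides $k$ if $k\neq0$. Let $\mathcal S_{\rm loc}(k,d)$ be the set of all noncrossing partitions $p$ such that 1. $c(p)\in k\mathbb Z$, and 2. whenever a rotated version of $p$ without upper points is of the form $p_1\otimes p_2$, where $p_1$ is possibly empty (then $c(p_1)=0$), $p_2$ has at least two points, and the first and the last point of $p_2$ belong to the same block, then: - $c(p_1)\in d\mathbb Z$ if these two points have different colors, - $c(p_1)\in d\mathbb Z+1$ if both are black, - $-c(p_1)\in d\mathbb Z+1$ if both are white. **Statement.** For all $k,d\in\mathbb N_0$ such that $d$ divides $k$ if $k\ne0$, $$\mathcal S_{\rm loc}(k,d)=\big\langle\, s_\circ^{\otimes k},\ \mathrm{pos}_d,\ f,\ s_\circ\otimes s_\bullet\,\big\rangle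 .$$ Moreover, these categories are pairwise different: if $(k,d)\neq(k',d')$ are two such pairs of parameters, then $\mathcal S_{\rm loc}(k,d)\neq\mathcal S_{\rm loc}(k',d')$. -/

import Mathlib

namespace TwoColored

open Sum

/-- The two colors of points. -/
inductive Color where
  | white : Color
  | black : Color
  deriving DecidableEq

/-- The inverse color. -/
def Color.inv : Color → Color
  | .white => .black
  | .black => .white

/-- A two-colored partition with `k` upper and `l` lower points (both rows are numbered from left to
right): a coloring of the points and a decomposition of the set of all points into blocks. -/
@[ext]
structure ColPart (k l : ℕ) where
  up : Fin k → Color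
  lo : Fin l → Color
  blocks : Setoid (Fin k ⊕ Fin l)

/-- A two-colored partition with any numbers of upper and lower points. -/
abbrev AnyColPart : Type := Σ k : ℕ, Σ l : ℕ, ColPart k l

/-- The disjoint union of two equivalence relations. -/
def sumSetoid {α β : Type} (r : Setoid α) (s : Setoid β) : Setoid (α ⊕ β) where
  r := Sum.LiftRel r s
  iseqv :=
    { refl := by
        rintro (a | b)
        · exact Sum.LiftRel.inl (r.refl' a)
        · exact Sum.LiftRel.inr (s.refl' b)
      symm := by
        rintro _ _ (h | h)
        · exact Sum.LiftRel.inl (r.symm' h)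
        · exact Sum.LiftRel.inr (s.symm' h)
      trans := by
        rintro _ _ _ (h | h) (h' | h')
        · exact Sum.LiftRel.inl (r.trans' h h')
        · exact Sum.LiftRel.inr (s.trans' h h') }

namespace ColPart

variable {k l m k' l' : ℕ}

/-- The points of two partitions placed side by side, sorted by the partition they come from. -/
def tensorSplit (k l k' l' : ℕ) :
    Fin (k + k') ⊕ Fin (l + l') → (Fin k ⊕ Fin l) ⊕ (Fin k' ⊕ Fin l') :=
  Sum.elim
    (Fin.addCases (fun i => inl (inl i)) (fun i => inr (inl i)))
    (Fin.addCases (fun j => inl (inr j)) (fun j => inr (inr j)))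

/-- Tensor product: `p` and `q` side by side, `p` on the left. -/
def tensor (p : ColPart k l) (q : ColPart k' l') : ColPart (k + k') (l + l') where
  up := Fin.append p.up q.up
  lo := Fin.append p.lo q.lo
  blocks := (sumSetoid p.blocks q.blocks).comap (tensorSplit k l k' l')

/-- The connections among upper, middle and lower points when `p` is placed below `q`. -/
inductive Glue (p : ColPart l m) (q : ColPart k l) :
    Fin k ⊕ (Fin l ⊕ Fin m) → Fin k ⊕ (Fin l ⊕ Fin m) → Prop
  | above (x y : Fin k ⊕ Fin l) :
      q.blocks x y → Glue p q (Sum.map id inl x) (Sum.map id inl y)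
  | below (x y : Fin l ⊕ Fin m) :
      p.blocks x y → Glue p q (inr x) (inr y)

/-- Composition `p q`: place `p` below `q`, connect, and remove the middle points. It is meaningful
only if the colors of the middle points match. -/
def comp (p : ColPart l m) (q : ColPart k l) : ColPart k m where
  up := q.up
  lo := p.lo
  blocks := (Relation.EqvGen.setoid (Glue p q)).comap (Sum.map id inr)

/-- Involution: reflection at the horizontal axis. -/
def invol (p : ColPart k l) : ColPart l k where
  up := p.lo
  lo := p.up
  blocks := p.blocks.comap Sum.swap

/-- Rotate the leftmost upper point to the left of the lower row. -/
def rotLeftDown (p : ColPart (k + 1) l) : ColPart k (l + 1) where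
  up := fun i => p.up i.succ
  lo := Fin.cons (p.up 0).inv p.lo
  blocks := p.blocks.comap
    (Sum.elim (fun i => inl i.succ) (Fin.cases (inl 0) (fun j => inr j)))

/-- Rotate the leftmost lower point to the left of the upper row. -/
def rotLeftUp (p : ColPart k (l + 1)) : ColPart (k + 1) l where
  up := Fin.cons (p.lo 0).inv p.up
  lo := fun j => p.lo j.succ
  blocks := p.blocks.comap
    (Sum.elim (Fin.cases (inr 0) (fun i => inl i)) (fun j => inr j.succ))

/-- Rotate the rightmost upper point to the right of the lower row. -/
def rotRightDown (p : ColPart (k + 1) l) : ColPart k (l + 1) where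
  up := fun i => p.up i.castSucc
  lo := Fin.snoc (α := fun _ => Color) p.lo (p.up (Fin.last k)).inv
  blocks := p.blocks.comap
    (Sum.elim (fun i => inl i.castSucc) (Fin.lastCases (inl (Fin.last k)) (fun j => inr j)))

/-- Rotate the rightmost lower point to the right of the upper row. -/
def rotRightUp (p : ColPart k (l + 1)) : ColPart (k + 1) l where
  up := Fin.snoc (α := fun _ => Color) p.up (p.lo (Fin.last l)).inv
  lo := fun j => p.lo j.castSucc
  blocks := p.blocks.comap
    (Sum.elim (Fin.lastCases (inr (Fin.last l)) (fun i => inl i)) (fun j => inr j.castSucc))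

/-- `IsRotation p q`: the partition `q` is a rotated version of `p`, that is, obtained from `p` by
finitely many rotations. -/
inductive IsRotation (p : ColPart k l) : ∀ {a b : ℕ}, ColPart a b → Prop
  | refl : IsRotation p p
  | leftDown {a b : ℕ} (q : ColPart (a + 1) b) : IsRotation p q → IsRotation p q.rotLeftDown
  | leftUp {a b : ℕ} (q : ColPart a (b + 1)) : IsRotation p q → IsRotation p q.rotLeftUp
  | rightDown {a b : ℕ} (q : ColPart (a + 1) b) : IsRotation p q → IsRotation p q.rotRightDown
  | rightUp {a b : ℕ} (q : ColPart a (b + 1)) : IsRotation p q → IsRotation p q.rotRightUp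

/-- The position of a point on the boundary of the strip, run through clockwise from the upper left
corner: upper points from left to right, then lower points from right to left. -/
def pos (k l : ℕ) : Fin k ⊕ Fin l → ℕ :=
  Sum.elim (fun i => i.val) (fun j => k + j.rev.val)

/-- A partition is noncrossing if no two different blocks interlace along the boundary. -/
def Noncrossing (p : ColPart k l) : Prop :=
  ∀ a b c d : Fin k ⊕ Fin l,
    pos k l a < pos k l b → pos k l b < pos k l c → pos k l c < pos k l d →
    p.blocks a c → p.blocks b d → p.blocks a b

/-- Number of white lower points plus number of black upper points. -/
def cWhite (p : ColPart k l) : ℕ :=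
  (Finset.univ.filter fun j => p.lo j = Color.white).card +
    (Finset.univ.filter fun i => p.up i = Color.black).card

/-- Number of black lower points plus number of white upper points. -/
def cBlack (p : ColPart k l) : ℕ :=
  (Finset.univ.filter fun j => p.lo j = Color.black).card +
    (Finset.univ.filter fun i => p.up i = Color.white).card

/-- The color sum of a partition. -/
def c (p : ColPart k l) : ℤ := (p.cWhite : ℤ) - (p.cBlack : ℤ)

/-- The partition without upper points given by a word: the `j`-th lower point has the color
`color j`, and two points are in the same block if and only if they have the same letter. -/
def ofWord {n : ℕ} (color : Fin n → Color) (letter : Fin n → ℕ) : ColPart 0 n where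
  up := Fin.elim0
  lo := color
  blocks := Setoid.ker (Sum.elim (fun i : Fin 0 => i.val) letter)

/-- The identity partition of a given color. -/
def idPart (x : Color) : ColPart 1 1 where
  up := fun _ => x
  lo := fun _ => x
  blocks := ⊤

/-- The pair partition on two lower points with colors `x`, `y`. -/
def pair (x y : Color) : ColPart 0 2 := ofWord ![x, y] ![0, 0]

/-- The singleton partition on one lower point. -/
def singleton (x : Color) : ColPart 0 1 := ofWord ![x] ![0]

/-- The `n`-th tensor power of the white singleton: `n` white lower points, all of them blocks of
size one. -/
def whiteSingletonPow (n : ℕ) : ColPart 0 n := ofWord (fun _ => Color.white) (fun j => j.val)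

/-- The `d`-positioner: from left to right `d` white singletons, the white leg of a pair,
`d` black singletons, and the black leg of this pair. -/
def positioner (d : ℕ) : ColPart 0 (2 * d + 2) :=
  ofWord (fun j => if j.val ≤ d then Color.white else Color.black)
    (fun j => if j.val = 2 * d + 1 then d else j.val)

/-- The block of four lower points with colors white, black, white, black. -/
def fourBlock : ColPart 0 4 :=
  ofWord ![Color.white, Color.black, Color.white, Color.black] ![0, 0, 0, 0]

end ColPart

open TwoColored.ColPart

/-- Categories of (two-colored) partitions. -/
structure IsCategory (C : Set AnyColPart) : Prop where
  tensor_mem : ∀ {k l k' l' : ℕ} (p : ColPart k l) (q : ColPart k' l'),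
    (⟨k, l, p⟩ : AnyColPart) ∈ C → (⟨k', l', q⟩ : AnyColPart) ∈ C →
      (⟨k + k', l + l', p.tensor q⟩ : AnyColPart) ∈ C
  comp_mem : ∀ {k l m : ℕ} (p : ColPart l m) (q : ColPart k l), q.lo = p.up →
    (⟨l, m, p⟩ : AnyColPart) ∈ C → (⟨k, l, q⟩ : AnyColPart) ∈ C →
      (⟨k, m, p.comp q⟩ : AnyColPart) ∈ C
  invol_mem : ∀ {k l : ℕ} (p : ColPart k l),
    (⟨k, l, p⟩ : AnyColPart) ∈ C → (⟨l, k, p.invol⟩ : AnyColPart) ∈ C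
  pair_white_black_mem : (⟨0, 2, pair .white .black⟩ : AnyColPart) ∈ C
  pair_black_white_mem : (⟨0, 2, pair .black .white⟩ : AnyColPart) ∈ C
  id_white_mem : (⟨1, 1, idPart .white⟩ : AnyColPart) ∈ C
  id_black_mem : (⟨1, 1, idPart .black⟩ : AnyColPart) ∈ C

/-- The category generated by a set of partitions: the smallest category containing it. -/
def generatedCategory (G : Set AnyColPart) : Set AnyColPart :=
  ⋂₀ {C : Set AnyColPart | IsCategory C ∧ G ⊆ C}

/-- The intersection of the categories containing `G` is itself a category. -/
theorem isCategory_generatedCategory (G : Set AnyColPart) : IsCategory (generatedCategory G) where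
  tensor_mem p q hp hq C hC := hC.1.tensor_mem p q (hp C hC) (hq C hC)
  comp_mem p q h hp hq C hC := hC.1.comp_mem p q h (hp C hC) (hq C hC)
  invol_mem p hp C hC := hC.1.invol_mem p (hp C hC)
  pair_white_black_mem _ hC := hC.1.pair_white_black_mem
  pair_black_white_mem _ hC := hC.1.pair_black_white_mem
  id_white_mem _ hC := hC.1.id_white_mem
  id_black_mem _ hC := hC.1.id_black_mem

/-- The local condition on a decomposition `p₁ ⊗ p₂` of a partition without upper points, where
`p₂` has at least two points: if the first and the last point of `p₂` belong to the same block,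
then the color sum of `p₁` (which may be empty) satisfies a congruence modulo `d` that depends on
the colors of these two points. -/
def LocalCondition (d : ℕ) {m n : ℕ} (p₁ : ColPart 0 m) (p₂ : ColPart 0 (n + 2)) : Prop :=
  p₂.blocks (inr 0) (inr (Fin.last (n + 1))) →
    (p₂.lo 0 ≠ p₂.lo (Fin.last (n + 1)) → (d : ℤ) ∣ p₁.c) ∧
    (p₂.lo 0 = Color.black → p₂.lo (Fin.last (n + 1)) = Color.black → (d : ℤ) ∣ p₁.c - 1) ∧
    (p₂.lo 0 = Color.white → p₂.lo (Fin.last (n + 1)) = Color.white → (d : ℤ) ∣ -p₁.c - 1)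

/-- The set `S_loc(k, d)`: all noncrossing partitions `p` with `c(p) ∈ kℤ` such that every rotated
version of `p` of the form `p₁ ⊗ p₂` without upper points satisfies the local condition. -/
def SLoc (k d : ℕ) : Set AnyColPart :=
  {x | x.2.2.Noncrossing ∧ (k : ℤ) ∣ x.2.2.c ∧
    ∀ (m n : ℕ) (p₁ : ColPart 0 m) (p₂ : ColPart 0 (n + 2)),
      IsRotation x.2.2 (p₁.tensor p₂) → LocalCondition d p₁ p₂}

/-- The generators of the category: the `k`-th power of the white singleton, the `d`-positioner, the
alternating four-block and the tensor product of a white and a black singleton. -/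
def SLocGenerators (k d : ℕ) : Set AnyColPart :=
  {⟨0, k, whiteSingletonPow k⟩, ⟨0, 2 * d + 2, positioner d⟩, ⟨0, 4, fourBlock⟩,
    ⟨0 + 0, 1 + 1, (ColPart.singleton .white).tensor (ColPart.singleton .black)⟩}

end TwoColored

/-!
All points of a partition can be rotated to the lower row, so that a partition becomes a word of
colored points in which every point carries the label of its block (`Rows`, `bar`). Reading such a
word from left to right, a white point is a step up and a black point is a step down. Let the
level of a point be the smaller one of the heights before and after its step. For a noncrossing
partition whose color sum is divisible by `d`, the local condition says that points of the same
block have the same level modulo `d`: it compares two consecutive points of a block, and the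
points between them form a union of blocks, which can be rotated to the front as `p₁`. Thus `SLoc
k d` consists of the noncrossing partitions with color sum in `kℤ` whose blocks have constant
level modulo `d` (`mem_SLoc_iff`).

*`SLoc k d` is a category* (`isCategory_SLoc`). Rotations shift all levels by the same amount
modulo `d`, and levels can be computed separately in the two rows. Hence they are compatible with
tensor products and compositions. A composition glues mirrored stretches of points and is obtained
by contracting adjacent points one pair after the other, starting from the middle; every single
contraction preserves the noncrossing property (`NoncrossingWord.contract`). As the generators
belong to `SLoc k d`, so does the category generated by them.

*The generators suffice* (`hasRows_of_noncrossingWord`). In a category, words can be rotated,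
inserted into each other, and contracted at adjacent points of inverse colors
(`HasRows.contract`). With `s_∘ ⊗ s_•` a point can be isolated from its block, and a word of
singletons can be replaced by any other word of singletons of the same color sum (`HasRows.swap`).
With the four-block a singleton can be joined to the block of an adjacent point of inverse color
(`HasRows.attach`). With the positioner this is also possible across singletons of color sum
divisible by `d` (`canReach_of_dvd`), and so it can be joined across singletons to any point of the
same level modulo `d` (`HasRows.reach`). Now let a
noncrossing word with constant levels modulo `d` on its blocks be given. If all points are
singletons, then it comes from a power of `s_∘^{⊗k}`. Otherwise there are two points of the same
block with only singletons in between; after one of them is isolated, induction applies, and the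
point can be joined to its block again.

*The parameters are determined by the set* (`dvd_of_SLoc_subset`): `s_∘^{⊗k}` has color sum `k`,
and the two legs of the pair in `pos_d` have levels that differ by `d`.
-/

namespace TwoColored

open Sum ColPart

section

variable {α β : Type}

/-! ### Words -/

/-- The value of a color: a white lower point counts `1` and a black one `-1`. -/
def Color.val : Color → ℤ
  | .white => 1
  | .black => -1

@[simp] lemma Color.inv_inv (e : Color) : e.inv.inv = e := by cases e <;> rfl

@[simp] lemma Color.val_inv (e : Color) : e.inv.val = -e.val := by cases e <;> rfl

/-- A row of points, read from left to right: every point is recorded by its color and the label of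
its block. -/
abbrev Word (α : Type) : Type := List (Color × α)

/-- The labels of a word. -/
def labels (w : Word α) : List α := w.map Prod.snd

/-- Replace every label `a` by `τ a`. -/
def relabel (τ : α → β) (w : Word α) : Word β := w.map fun x => (x.1, τ x.2)

/-- The color sum of a word. -/
def csum (w : Word α) : ℤ := (w.map fun x => x.1.val).sum

/-- The inverse of a letter: inverse color, same label. -/
def invLetter (x : Color × α) : Color × α := (x.1.inv, x.2)

/-- The word obtained when a row is moved to the other side of the strip: the order of the points is
reversed and the colors are inverted. -/
def bar (w : Word α) : Word α := (w.map invLetter).reverse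

@[simp] lemma labels_nil : labels ([] : Word α) = [] := rfl
@[simp] lemma labels_cons (x : Color × α) (w : Word α) : labels (x :: w) = x.2 :: labels w := rfl
@[simp] lemma labels_append (w v : Word α) : labels (w ++ v) = labels w ++ labels v := by
  simp [labels]
@[simp] lemma labels_bar (w : Word α) : labels (bar w) = (labels w).reverse := by
  simp [labels, bar, invLetter, Function.comp_def]
@[simp] lemma labels_relabel (τ : α → β) (w : Word α) :
    labels (relabel τ w) = (labels w).map τ := by
  simp [labels, relabel, Function.comp_def]

@[simp] lemma relabel_nil (τ : α → β) : relabel τ [] = [] := rfl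
@[simp] lemma relabel_cons (τ : α → β) (x : Color × α) (w : Word α) :
    relabel τ (x :: w) = (x.1, τ x.2) :: relabel τ w := rfl
@[simp] lemma relabel_append (τ : α → β) (w v : Word α) :
    relabel τ (w ++ v) = relabel τ w ++ relabel τ v := by
  simp [relabel]
@[simp] lemma relabel_relabel {γ : Type} (σ : β → γ) (τ : α → β) (w : Word α) :
    relabel σ (relabel τ w) = relabel (σ ∘ τ) w := by
  simp [relabel, Function.comp_def]
@[simp] lemma relabel_bar (τ : α → β) (w : Word α) : relabel τ (bar w) = bar (relabel τ w) := by
  simp [relabel, bar, invLetter, Function.comp_def]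

lemma relabel_congr {τ σ : α → β} {w : Word α} (h : ∀ a ∈ labels w, τ a = σ a) :
    relabel τ w = relabel σ w := by
  refine List.map_congr_left fun x hx => ?_
  rw [h x.2 (List.mem_map_of_mem hx)]

lemma relabel_eq_self {τ : α → α} {w : Word α} (h : ∀ a ∈ labels w, τ a = a) :
    relabel τ w = w := by
  rw [relabel_congr (σ := id) h]
  simp [relabel]

lemma relabel_update_of_notMem [DecidableEq α] {w : Word α} {a : α} (b : α) (h : a ∉ labels w) :
    relabel (Function.update id a b) w = w :=
  relabel_eq_self fun c hc => Function.update_of_ne (fun hca => h (by rwa [← hca])) _ _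

@[simp] lemma csum_nil : csum ([] : Word α) = 0 := rfl
@[simp] lemma csum_cons (x : Color × α) (w : Word α) : csum (x :: w) = x.1.val + csum w := by
  simp [csum]
@[simp] lemma csum_append (w v : Word α) : csum (w ++ v) = csum w + csum v := by
  simp [csum]
@[simp] lemma csum_bar (w : Word α) : csum (bar w) = -csum w := by
  induction w with
  | nil => rfl
  | cons x w ih =>
    have : bar (x :: w) = bar w ++ [invLetter x] := by simp [bar]
    rw [this, csum_append, ih]
    simp [invLetter]
@[simp] lemma csum_relabel (τ : α → β) (w : Word α) : csum (relabel τ w) = csum w := by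
  simp [csum, relabel, Function.comp_def]

lemma csum_eq_of_fst {w : Word α} {v : Word β} (h : w.map Prod.fst = v.map Prod.fst) :
    csum w = csum v := by
  have := congrArg (fun l => (l.map Color.val).sum) h
  simpa [csum, Function.comp_def] using this

@[simp] lemma bar_nil : bar ([] : Word α) = [] := rfl
@[simp] lemma bar_cons (x : Color × α) (w : Word α) : bar (x :: w) = bar w ++ [invLetter x] := by
  simp [bar]
@[simp] lemma bar_append (w v : Word α) : bar (w ++ v) = bar v ++ bar w := by
  simp [bar]
@[simp] lemma invLetter_invLetter (x : Color × α) : invLetter (invLetter x) = x := by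
  simp [invLetter]
@[simp] lemma bar_bar (w : Word α) : bar (bar w) = w := by
  simp [bar, Function.comp_def]

/-! ### Partitions as pairs of words -/

/-- `Rows p u v`: the words `u` and `v` are the rows of `p`, with labels that separate the blocks. -/
def Rows {k l : ℕ} (p : ColPart k l) (u v : Word α) : Prop :=
  ∃ f : Fin k ⊕ Fin l → α, p.blocks = Setoid.ker f ∧
    u = List.ofFn (fun i => (p.up i, f (inl i))) ∧ v = List.ofFn (fun j => (p.lo j, f (inr j)))

variable {k l m k' l' : ℕ}

lemma exists_rows (p : ColPart k l) : ∃ u v : Word ℕ, Rows p u v := by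
  obtain ⟨g, hg⟩ := exists_injective_nat (Quotient p.blocks)
  refine ⟨_, _, fun x => g ⟦x⟧, ?_, rfl, rfl⟩
  ext x y
  simp only [Setoid.ker_def, hg.eq_iff, Quotient.eq]

lemma exists_colPart (u v : Word α) : ∃ p : ColPart u.length v.length, Rows p u v :=
  ⟨⟨fun i => (u.get i).1, fun j => (v.get j).1,
    Setoid.ker (Sum.elim (fun i => (u.get i).2) (fun j => (v.get j).2))⟩, _, rfl,
    by simp, by simp⟩

lemma Rows.up_length {p : ColPart k l} {u v : Word α} (h : Rows p u v) : u.length = k := by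
  obtain ⟨f, -, rfl, -⟩ := h; simp

lemma Rows.lo_length {p : ColPart k l} {u v : Word α} (h : Rows p u v) : v.length = l := by
  obtain ⟨f, -, -, rfl⟩ := h; simp

/-- A partition is determined by its rows. -/
lemma Rows.unique {p : ColPart k l} {q : ColPart k' l'} {u v : Word α} (hp : Rows p u v)
    (hq : Rows q u v) : (⟨k, l, p⟩ : AnyColPart) = ⟨k', l', q⟩ := by
  obtain rfl : k = k' := hp.up_length.symm.trans hq.up_length
  obtain rfl : l = l' := hp.lo_length.symm.trans hq.lo_length
  obtain ⟨f, hf, rfl, rfl⟩ := hp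
  obtain ⟨g, hg, hu, hv⟩ := hq
  have hu := List.ofFn_injective hu
  have hv := List.ofFn_injective hv
  have hfg : f = g := by
    funext x
    rcases x with i | j
    · exact congrArg Prod.snd (congrFun hu i)
    · exact congrArg Prod.snd (congrFun hv j)
  have : p = q := by
    ext1
    · exact funext fun i => congrArg Prod.fst (congrFun hu i)
    · exact funext fun j => congrArg Prod.fst (congrFun hv j)
    · rw [hf, hg, hfg]
  rw [this]

lemma Rows.map {p : ColPart k l} {u v : Word α} (h : Rows p u v) (τ : α → β)
    (hτ : ∀ a ∈ labels (u ++ v), ∀ b ∈ labels (u ++ v), τ a = τ b → a = b) :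
    Rows p (relabel τ u) (relabel τ v) := by
  obtain ⟨f, hf, rfl, rfl⟩ := h
  refine ⟨τ ∘ f, ?_, ?_, ?_⟩
  · have key : ∀ x, f x ∈ labels (List.ofFn (fun i => (p.up i, f (inl i))) ++
        List.ofFn (fun j => (p.lo j, f (inr j)))) := by
      rintro (i | j) <;> simp [labels, List.mem_ofFn]
    ext x y
    rw [hf, Setoid.ker_def, Setoid.ker_def]
    exact ⟨fun h => congrArg τ h, hτ _ (key x) _ (key y)⟩
  · simp [relabel, Function.comp_def]
  · simp [relabel, Function.comp_def]

lemma Rows.invol {p : ColPart k l} {u v : Word α} (h : Rows p u v) : Rows p.invol v u := by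
  obtain ⟨f, hf, rfl, rfl⟩ := h
  refine ⟨f ∘ Sum.swap, ?_, rfl, rfl⟩
  rw [ColPart.invol, hf]
  rfl

lemma Rows.tensor {p : ColPart k l} {q : ColPart k' l'} {u v u' v' : Word α} (hp : Rows p u v)
    (hq : Rows q u' v') (hd : ∀ a ∈ labels (u ++ v), a ∉ labels (u' ++ v')) :
    Rows (p.tensor q) (u ++ u') (v ++ v') := by
  obtain ⟨f, hf, rfl, rfl⟩ := hp
  obtain ⟨g, hg, rfl, rfl⟩ := hq
  have hfg : ∀ x y, f x ≠ g y := by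
    intro x y hxy
    refine hd (f x) ?_ (hxy ▸ ?_)
    · rcases x with i | j <;> simp [labels, List.mem_ofFn]
    · rcases y with i | j <;> simp [labels, List.mem_ofFn]
  refine ⟨Sum.elim f g ∘ tensorSplit k l k' l', ?_, ?_, ?_⟩
  · have : sumSetoid p.blocks q.blocks = Setoid.ker (Sum.elim f g) := by
      ext x y
      rw [Setoid.ker_def]
      change Sum.LiftRel _ _ x y ↔ _
      rcases x with x | x <;> rcases y with y | y
      · rw [hf]; simp [Setoid.ker_def]
      · simp [hfg]
      · simpa using (hfg y x).symm
      · rw [hg]; simp [Setoid.ker_def]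
    rw [ColPart.tensor, this]
    rfl
  · rw [← List.ofFn_fin_append]
    congr 1
    funext i
    refine Fin.addCases (fun i => ?_) (fun i => ?_) i <;> simp [ColPart.tensor, tensorSplit]
  · rw [← List.ofFn_fin_append]
    congr 1
    funext i
    refine Fin.addCases (fun i => ?_) (fun i => ?_) i <;> simp [ColPart.tensor, tensorSplit]

lemma Rows.rotLeftDown {p : ColPart (k + 1) l} {u v : Word α} (h : Rows p u v) :
    ∃ x u', u = x :: u' ∧ Rows p.rotLeftDown u' (invLetter x :: v) := by
  obtain ⟨f, hf, rfl, rfl⟩ := h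
  refine ⟨_, _, List.ofFn_succ,
    f ∘ Sum.elim (fun i => inl i.succ) (Fin.cases (inl 0) (fun j => inr j)), ?_, ?_, ?_⟩
  · rw [ColPart.rotLeftDown, hf]
    rfl
  · rfl
  · rw [List.ofFn_succ]; rfl

lemma Rows.rotLeftUp {p : ColPart k (l + 1)} {u v : Word α} (h : Rows p u v) :
    ∃ x v', v = x :: v' ∧ Rows p.rotLeftUp (invLetter x :: u) v' := by
  obtain ⟨f, hf, rfl, rfl⟩ := h
  refine ⟨_, _, List.ofFn_succ,
    f ∘ Sum.elim (Fin.cases (inr 0) (fun i => inl i)) (fun j => inr j.succ), ?_, ?_, ?_⟩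
  · rw [ColPart.rotLeftUp, hf]
    rfl
  · rw [List.ofFn_succ]; rfl
  · rfl

lemma Rows.rotRightDown {p : ColPart (k + 1) l} {u v : Word α} (h : Rows p u v) :
    ∃ x u', u = u' ++ [x] ∧ Rows p.rotRightDown u' (v ++ [invLetter x]) := by
  obtain ⟨f, hf, rfl, rfl⟩ := h
  refine ⟨_, _, (List.ofFn_succ' _).trans List.concat_eq_append,
    f ∘ Sum.elim (fun i => inl i.castSucc) (Fin.lastCases (inl (Fin.last k)) (fun j => inr j)),
    ?_, ?_, ?_⟩
  · rw [ColPart.rotRightDown, hf]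
    rfl
  · rfl
  · rw [List.ofFn_succ', List.concat_eq_append]
    simp [ColPart.rotRightDown, invLetter]

lemma Rows.rotRightUp {p : ColPart k (l + 1)} {u v : Word α} (h : Rows p u v) :
    ∃ x v', v = v' ++ [x] ∧ Rows p.rotRightUp (u ++ [invLetter x]) v' := by
  obtain ⟨f, hf, rfl, rfl⟩ := h
  refine ⟨_, _, (List.ofFn_succ' _).trans List.concat_eq_append,
    f ∘ Sum.elim (Fin.lastCases (inr (Fin.last l)) (fun i => inl i)) (fun j => inr j.castSucc),
    ?_, ?_, ?_⟩
  · rw [ColPart.rotRightUp, hf]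
    rfl
  · rw [List.ofFn_succ', List.concat_eq_append]
    simp [ColPart.rotRightUp, invLetter]
  · rfl

/-- The blocks of a composition in terms of labels: if `σ` identifies exactly those labels that are
connected through middle points, then composition amounts to relabeling by `σ`. -/
lemma Rows.comp {p : ColPart l m} {q : ColPart k l} {u v v' z : Word α} (hq : Rows q u v)
    (hp : Rows p v' z) (hd : ∀ a ∈ labels (u ++ v), a ∉ labels (v' ++ z)) (σ : α → α)
    (h1 : ∀ s t, (s, t) ∈ (labels v).zip (labels v') → σ s = σ t)
    (h2 : ∀ s ∈ labels (u ++ v) ++ labels (v' ++ z),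
      Relation.EqvGen (fun s t => (s, t) ∈ (labels v).zip (labels v')) s (σ s)) :
    Rows (p.comp q) (relabel σ u) (relabel σ z) := by
  obtain ⟨f, hf, rfl, rfl⟩ := hq
  obtain ⟨g, hg, rfl, rfl⟩ := hp
  have hfl : ∀ x, f x ∈ labels (List.ofFn (fun i => (q.up i, f (inl i))) ++
      List.ofFn (fun j => (q.lo j, f (inr j)))) := by
    rintro (i | j) <;> simp [labels, List.mem_ofFn]
  have hgl : ∀ x, g x ∈ labels (List.ofFn (fun i => (p.up i, g (inl i))) ++
      List.ofFn (fun j => (p.lo j, g (inr j)))) := by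
    rintro (i | j) <;> simp [labels, List.mem_ofFn]
  have hzip : ∀ s t, (s, t) ∈ (labels (List.ofFn (fun j => (q.lo j, f (inr j))))).zip
      (labels (List.ofFn (fun i => (p.up i, g (inl i))))) ↔ ∃ i, f (inr i) = s ∧ g (inl i) = t := by
    intro s t
    have : (labels (List.ofFn (fun j => (q.lo j, f (inr j))))).zip
      (labels (List.ofFn (fun i => (p.up i, g (inl i))))) =
        List.ofFn (fun i : Fin l => (f (inr i), g (inl i))) := by
      apply List.ext_getElem <;> simp [labels]
    rw [this, List.mem_ofFn]
    simp
  have hfg : ∀ x y, f x ≠ g y := fun x y hxy => hd _ (hfl x) (hxy ▸ hgl y)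
  simp only [hzip] at h1 h2
  -- `Inc x s`: the glued point `x` carries the label `s`; middle points carry two labels.
  let Inc : Fin k ⊕ (Fin l ⊕ Fin m) → α → Prop := fun x s =>
    (∃ y, x = Sum.map id inl y ∧ f y = s) ∨ (∃ y, x = inr y ∧ g y = s)
  have hinc : ∀ s x y, Inc x s → Inc y s → Relation.EqvGen (Glue p q) x y := by
    rintro s x y (⟨x', rfl, hx⟩ | ⟨x', rfl, hx⟩) (⟨y', rfl, hy⟩ | ⟨y', rfl, hy⟩)
    · exact .rel _ _ (.above _ _ (by rw [hf, Setoid.ker_def, hx, hy]))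
    · exact absurd (hx.trans hy.symm) (hfg _ _)
    · exact absurd (hy.trans hx.symm) (hfg _ _)
    · exact .rel _ _ (.below _ _ (by rw [hg, Setoid.ker_def, hx, hy]))
  have hgen : ∀ s t, Relation.EqvGen (fun s t => ∃ i, f (inr i) = s ∧ g (inl i) = t) s t →
      s = t ∨ ((∃ x, Inc x s) ∧ (∃ y, Inc y t) ∧
        ∀ x y, Inc x s → Inc y t → Relation.EqvGen (Glue p q) x y) := by
    intro s t h
    induction h with
    | rel s t h =>
      obtain ⟨i, rfl, rfl⟩ := h
      have a1 : Inc (inr (inl i)) (f (inr i)) := Or.inl ⟨inr i, rfl, rfl⟩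
      have a2 : Inc (inr (inl i)) (g (inl i)) := Or.inr ⟨inl i, rfl, rfl⟩
      exact Or.inr ⟨⟨_, a1⟩, ⟨_, a2⟩, fun x y hx hy =>
        (hinc _ _ _ hx a1).trans _ _ _ (hinc _ _ _ a2 hy)⟩
    | refl s => exact Or.inl rfl
    | symm s t _ ih =>
      rcases ih with rfl | ⟨h1, h2, h3⟩
      · exact Or.inl rfl
      · exact Or.inr ⟨h2, h1, fun x y hx hy => (h3 y x hy hx).symm⟩
    | trans s r t _ _ ih1 ih2 =>
      rcases ih1 with rfl | ⟨a1, a2, a3⟩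
      · exact ih2
      rcases ih2 with rfl | ⟨b1, b2, b3⟩
      · exact Or.inr ⟨a1, a2, a3⟩
      obtain ⟨w, hw⟩ := a2
      exact Or.inr ⟨a1, b2, fun x y hx hy => (a3 x w hx hw).trans _ _ _ (b3 w y hw hy)⟩
  refine ⟨Sum.elim (fun i => σ (f (inl i))) (fun j => σ (g (inr j))), ?_, ?_, ?_⟩
  · -- The label after relabeling is a well-defined function of the glued points.
    let F : Fin k ⊕ (Fin l ⊕ Fin m) → α :=
      Sum.elim (fun i => σ (f (inl i))) (fun y => σ (g y))
    have hF1 : ∀ y, F (Sum.map id inl y) = σ (f y) := by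
      rintro (i | j)
      · rfl
      · exact (h1 _ _ ⟨j, rfl, rfl⟩).symm
    have hF : ∀ x y, Relation.EqvGen (Glue p q) x y ↔ F x = F y := by
      intro x y
      constructor
      · intro h
        induction h with
        | rel x y h =>
          rcases h with ⟨x, y, h⟩ | ⟨x, y, h⟩
          · rw [hf, Setoid.ker_def] at h
            rw [hF1, hF1, h]
          · rw [hg, Setoid.ker_def] at h
            exact congrArg σ h
        | refl x => rfl
        | symm x y _ ih => exact ih.symm
        | trans x y z _ _ ih1 ih2 => exact ih1.trans ih2
      · intro h
        have hex : ∀ x, ∃ s ∈ labels (List.ofFn (fun i => (q.up i, f (inl i))) ++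
            List.ofFn (fun j => (q.lo j, f (inr j)))) ++
            labels (List.ofFn (fun i => (p.up i, g (inl i))) ++
            List.ofFn (fun j => (p.lo j, g (inr j)))), Inc x s ∧ F x = σ s := by
          rintro (i | y)
          · exact ⟨f (inl i), List.mem_append_left _ (hfl _), Or.inl ⟨inl i, rfl, rfl⟩, rfl⟩
          · exact ⟨g y, List.mem_append_right _ (hgl _), Or.inr ⟨y, rfl, rfl⟩, rfl⟩
        obtain ⟨s, hs, hxs, hxF⟩ := hex x
        obtain ⟨t, ht, hyt, hyF⟩ := hex y
        have hst := (h2 s hs).trans _ _ _ ((hxF ▸ hyF ▸ h : σ s = σ t) ▸ (h2 t ht).symm)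
        rcases hgen s t hst with rfl | ⟨-, -, h3⟩
        · exact hinc _ _ _ hxs hyt
        · exact h3 _ _ hxs hyt
    ext x y
    rw [Setoid.ker_def]
    refine (hF (Sum.map id inr x) (Sum.map id inr y)).trans ?_
    rcases x with x | x <;> rcases y with y | y <;> rfl
  · simp [relabel, Function.comp_def, ColPart.comp]
  · simp [relabel, Function.comp_def, ColPart.comp]

end

section

variable {α β : Type}

/-! ### Categories in terms of words -/

/-- `HasRows C u v`: some partition in `C` has the rows `u` and `v`. -/
def HasRows (C : Set AnyColPart) (u v : Word α) : Prop :=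
  ∃ (k l : ℕ) (p : ColPart k l), Rows p u v ∧ (⟨k, l, p⟩ : AnyColPart) ∈ C

variable {C : Set AnyColPart}

lemma HasRows.mem {k l : ℕ} {p : ColPart k l} {u v : Word α} (h : HasRows C u v)
    (hp : Rows p u v) : (⟨k, l, p⟩ : AnyColPart) ∈ C := by
  obtain ⟨k', l', q, hq, hqC⟩ := h
  rwa [hp.unique hq]

lemma HasRows.map {u v : Word α} (h : HasRows C u v) (τ : α → β)
    (hτ : ∀ a ∈ labels (u ++ v), ∀ b ∈ labels (u ++ v), τ a = τ b → a = b) :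
    HasRows C (relabel τ u) (relabel τ v) := by
  obtain ⟨k, l, p, hp, hC⟩ := h
  exact ⟨k, l, p, hp.map τ hτ, hC⟩

lemma HasRows.invol (hC : IsCategory C) {u v : Word α} (h : HasRows C u v) : HasRows C v u := by
  obtain ⟨k, l, p, hp, hpC⟩ := h
  exact ⟨l, k, p.invol, hp.invol, hC.invol_mem p hpC⟩

lemma HasRows.tensor (hC : IsCategory C) {u v u' v' : Word α} (h : HasRows C u v)
    (h' : HasRows C u' v') (hd : ∀ a ∈ labels (u ++ v), a ∉ labels (u' ++ v')) :
    HasRows C (u ++ u') (v ++ v') := by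
  obtain ⟨k, l, p, hp, hpC⟩ := h
  obtain ⟨k', l', q, hq, hqC⟩ := h'
  exact ⟨_, _, p.tensor q, hp.tensor hq hd, hC.tensor_mem p q hpC hqC⟩

lemma rows_idPart (e : Color) (a : α) : Rows (idPart e) [(e, a)] [(e, a)] := by
  refine ⟨fun _ => a, ?_, by simp [idPart], by simp [idPart]⟩
  ext x y
  exact ⟨fun _ => rfl, fun _ => trivial⟩

lemma rows_ofWord {n : ℕ} (color : Fin n → Color) (letter : Fin n → ℕ) :
    Rows (ofWord color letter) [] (List.ofFn fun j => (color j, letter j)) :=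
  ⟨_, rfl, by simp, rfl⟩

lemma rows_pair (e e' : Color) (a : α) : Rows (pair e e') [] [(e, a), (e', a)] := by
  have := (rows_ofWord ![e, e'] ![0, 0]).map (fun _ => a) (by
    simp [labels, List.ofFn_succ])
  simpa [pair, relabel, List.ofFn_succ] using this

lemma hasRows_id (hC : IsCategory C) (x : Color × α) : HasRows C [x] [x] :=
  ⟨_, _, _, rows_idPart x.1 x.2, by
    obtain ⟨e, a⟩ := x
    cases e
    · exact hC.id_white_mem
    · exact hC.id_black_mem⟩

lemma hasRows_pair (hC : IsCategory C) (e : Color) (a : α) :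
    HasRows C [] [(e, a), (e.inv, a)] :=
  ⟨_, _, _, rows_pair e e.inv a, by
    cases e
    · exact hC.pair_white_black_mem
    · exact hC.pair_black_white_mem⟩

lemma hasRows_nil (hC : IsCategory C) : HasRows C ([] : Word α) [] := by
  have h := hC.comp_mem _ _ rfl (hC.invol_mem _ hC.pair_white_black_mem) hC.pair_white_black_mem
  exact ⟨0, 0, _, ⟨Sum.elim Fin.elim0 Fin.elim0, Setoid.ext fun x => x.elim Fin.elim0 Fin.elim0,
    by simp, by simp⟩, h⟩

lemma hasRows_idWord (hC : IsCategory C) (w : Word α) (hw : (labels w).Nodup) :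
    HasRows C w w := by
  induction w with
  | nil => exact hasRows_nil hC
  | cons x w ih =>
    rw [labels_cons, List.nodup_cons] at hw
    refine (hasRows_id hC x).tensor hC (ih hw.2) ?_
    simpa using hw.1

/-- The word `w` with all labels made distinct: the point at position `i` gets the pair of `n + i`
and its old label as its new label. -/
def indexed (n : ℕ) (w : Word α) : Word (ℕ × α) := (w.zipIdx n).map fun x => (x.1.1, (x.2, x.1.2))

lemma labels_indexed (n : ℕ) (w : Word α) :
    labels (indexed n w) = ((labels w).zipIdx n).map Prod.swap := by
  simp only [indexed, labels, List.zipIdx_map, List.map_map]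
  rfl

lemma map_fst_indexed (n : ℕ) (w : Word α) : (indexed n w).map Prod.fst = w.map Prod.fst := by
  induction w generalizing n with
  | nil => rfl
  | cons x w ih => simpa [indexed] using ih (n + 1)

lemma relabel_snd_indexed (n : ℕ) (w : Word α) : relabel Prod.snd (indexed n w) = w := by
  induction w generalizing n with
  | nil => rfl
  | cons x w ih => simpa [indexed, relabel] using ih (n + 1)

lemma le_of_mem_indexed {n : ℕ} {w : Word α} {s : ℕ × α} (h : s ∈ labels (indexed n w)) :
    n ≤ s.1 ∧ s.1 < n + w.length := by
  rw [labels_indexed, List.mem_map] at h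
  obtain ⟨⟨a, i⟩, h, rfl⟩ := h
  have := List.mem_zipIdx h
  simp only [labels, List.length_map] at this
  exact ⟨this.1, this.2.1⟩

lemma nodup_indexed (n : ℕ) (w : Word α) : (labels (indexed n w)).Nodup := by
  apply List.Nodup.of_map Prod.fst
  rw [labels_indexed, List.map_map]
  have : (Prod.fst ∘ Prod.swap : α × ℕ → ℕ) = Prod.snd := rfl
  rw [this, List.zipIdx_map_snd]
  exact List.nodup_range'

lemma mem_zip_indexed {n : ℕ} {w : Word α} {s : α} {t : ℕ × α}
    (h : (s, t) ∈ (labels w).zip (labels (indexed n w))) : t.2 = s := by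
  induction w generalizing n with
  | nil => simp at h
  | cons x w ih =>
    rcases List.mem_cons.1 h with h | h
    · cases h; rfl
    · exact ih h

lemma exists_mem_zip_indexed {n : ℕ} {w : Word α} {t : ℕ × α} (h : t ∈ labels (indexed n w)) :
    (t.2, t) ∈ (labels w).zip (labels (indexed n w)) := by
  induction w generalizing n with
  | nil => simp [indexed] at h
  | cons x w ih =>
    rcases List.mem_cons.1 h with h | h
    · cases h; exact List.mem_cons_self
    · exact List.mem_cons_of_mem _ (ih h)

/-- Composition with a reflected pair partition: adjacent lower points of inverse colors are
contracted, which joins their blocks. -/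
lemma HasRows.contract (hC : IsCategory C) {u A B : Word α} {e : Color} {a b : α} {τ : α → α}
    (h : HasRows C u (A ++ (e, a) :: (e.inv, b) :: B)) (hτ : ∀ t, t ≠ a → t ≠ b → τ t = t)
    (hab : τ a = τ b) (hab' : τ a = a ∨ τ a = b) :
    HasRows C (relabel τ u) (relabel τ (A ++ B)) := by
  set v := A ++ (e, a) :: (e.inv, b) :: B with hv
  obtain ⟨n, hn⟩ : ∃ n, n = A.length := ⟨_, rfl⟩
  let iota : α → α ⊕ (ℕ × α) := inl
  let kappa : ℕ × α → α ⊕ (ℕ × α) := inr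
  -- The word is composed with `id ⊗ cap ⊗ id`. The label of an upper point of this partition is the
  -- pair of a position and the label of the point of `v` above it. The two legs of the cap are the
  -- exception: they share one label, so the index of `B` continues with `n + 1`.
  let A' := indexed 0 A
  let B' := indexed (n + 1) B
  let cap : Word (ℕ × α) := [(e, (n, a)), (e.inv, (n, a))]
  have hA : ∀ s ∈ labels A', s.1 < n := fun s hs => by
    have := (le_of_mem_indexed hs).2; omega
  have hB : ∀ s ∈ labels B', n < s.1 := fun s hs => (le_of_mem_indexed hs).1
  have hr : HasRows C (A' ++ (cap ++ B')) (A' ++ ([] ++ B')) := by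
    refine (hasRows_idWord hC A' (nodup_indexed _ _)).tensor hC
      (((hasRows_pair hC e _).invol hC).tensor hC (hasRows_idWord hC B' (nodup_indexed _ _)) ?_) ?_
    · intro s hs hs'
      have h1 : s.1 = n := by
        simp only [labels_cons, labels_nil, List.append_nil, List.mem_cons,
          List.not_mem_nil, or_false, or_self] at hs
        rw [hs]
      have h2 := hB s (by simpa using hs')
      omega
    · intro s hs hs'
      have h1 := hA s (by simpa using hs)
      have h2 : s = (n, a) ∨ s ∈ labels B' := by simpa [cap] using hs'
      rcases h2 with rfl | h2
      · exact absurd h1 (lt_irrefl n)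
      · have := hB s h2; omega
  have hr := hr.map kappa fun _ _ _ _ h => inr_injective h
  have hq := h.map iota fun _ _ _ _ h => inl_injective h
  obtain ⟨k, l, q, hq, hqC⟩ := hq
  obtain ⟨l', m, p, hp, hpC⟩ := hr
  have hfst : (relabel iota v).map Prod.fst = (relabel kappa (A' ++ (cap ++ B'))).map Prod.fst := by
    have h1 : ∀ (γ : Type) (f : α → γ) (w : Word α),
        (relabel f w).map Prod.fst = w.map Prod.fst := by
      intro γ f w; simp [relabel]
    have h2 : ∀ (γ : Type) (f : ℕ × α → γ) (w : Word (ℕ × α)),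
        (relabel f w).map Prod.fst = w.map Prod.fst := by
      intro γ f w; simp [relabel]
    rw [h1, h2]
    simp [hv, A', B', cap, map_fst_indexed]
  obtain rfl : l = l' := by
    rw [← hq.lo_length, ← hp.up_length, ← List.length_map Prod.fst, hfst, List.length_map]
  have hcol : q.lo = p.up := by
    obtain ⟨f, -, -, hf⟩ := hq
    obtain ⟨g, -, hg, -⟩ := hp
    rw [hf, hg] at hfst
    simp only [List.map_ofFn] at hfst
    exact List.ofFn_injective hfst
  let σ : α ⊕ (ℕ × α) → α ⊕ (ℕ × α) := Sum.elim (fun s => inl (τ s)) (fun t => inl (τ t.2))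
  have hzip : ∀ x, x ∈ (labels (relabel iota v)).zip (labels (relabel kappa (A' ++ (cap ++ B')))) ↔
      ∃ s t, x = (inl s, inr t) ∧ ((s, t) ∈ (labels A).zip (labels A') ∨ (s = a ∧ t = (n, a)) ∨
        (s = b ∧ t = (n, a)) ∨ (s, t) ∈ (labels B).zip (labels B')) := by
    intro x
    have hlen : (labels A).length = (labels A').length := by
      simp [labels, A', indexed]
    rw [labels_relabel, labels_relabel, List.zip_map, hv, labels_append, labels_append,
      List.zip_append hlen]
    simp only [List.mem_map, List.mem_append, labels_cons, cap,
      List.cons_append, List.nil_append, List.zip_cons_cons, List.mem_cons, Prod.exists, iota, kappa,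
      Prod.map_apply, Prod.mk.injEq]
    constructor
    · rintro ⟨s, i, c, h, rfl⟩
      exact ⟨s, i, c, rfl, by simpa using h⟩
    · rintro ⟨s, i, c, rfl, h⟩
      exact ⟨s, i, c, by simpa using h, rfl⟩
  have hdis : ∀ s ∈ labels (relabel iota u ++ relabel iota v),
      s ∉ labels (relabel kappa (A' ++ (cap ++ B')) ++ relabel kappa (A' ++ ([] ++ B'))) := by
    intro s hs hs'
    rw [← relabel_append, labels_relabel, List.mem_map] at hs hs'
    obtain ⟨x, -, rfl⟩ := hs
    obtain ⟨y, -, h⟩ := hs'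
    cases h
  have hcomp := hq.comp hp hdis σ ?_ ?_
  · have hmem := hC.comp_mem p q hcol hpC hqC
    have hres : HasRows C (relabel σ (relabel iota u))
        (relabel σ (relabel kappa (A' ++ ([] ++ B')))) := ⟨_, _, _, hcomp, hmem⟩
    have e1 : relabel σ (relabel iota u) = relabel iota (relabel τ u) := by
      simp only [relabel_relabel]; rfl
    have e2 : relabel σ (relabel kappa (A' ++ ([] ++ B'))) = relabel iota (relabel τ (A ++ B)) := by
      have : σ ∘ kappa = (iota ∘ τ) ∘ Prod.snd := rfl
      rw [relabel_relabel, this, ← relabel_relabel]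
      simp [A', B', relabel_snd_indexed]
    rw [e1, e2] at hres
    have := hres.map (Sum.elim id Prod.snd) ?_
    · have hid : (Sum.elim id Prod.snd ∘ iota : α → α) = id := rfl
      rw [relabel_relabel, relabel_relabel (σ := Sum.elim id Prod.snd), hid,
        relabel_eq_self (τ := id) (fun _ _ => rfl), relabel_eq_self (τ := id) (fun _ _ => rfl)] at this
      exact this
    · intro s hs t ht hst
      rw [← relabel_append, labels_relabel, List.mem_map] at hs ht
      obtain ⟨x, -, rfl⟩ := hs
      obtain ⟨y, -, rfl⟩ := ht
      exact congrArg inl hst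
  · intro s t hst
    obtain ⟨s, t, h, h'⟩ := (hzip _).1 hst
    cases h
    change (inl (τ s) : α ⊕ (ℕ × α)) = inl (τ t.2)
    rcases h' with h' | ⟨rfl, rfl⟩ | ⟨rfl, rfl⟩ | h'
    · rw [mem_zip_indexed h']
    · rfl
    · rw [hab]
    · rw [mem_zip_indexed h']
  · set R : α ⊕ (ℕ × α) → α ⊕ (ℕ × α) → Prop := fun s t => (s, t) ∈
      (labels (relabel iota v)).zip (labels (relabel kappa (A' ++ (cap ++ B')))) with hR
    have ha : Relation.EqvGen R (inl a) (inr (n, a)) :=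
      .rel _ _ ((hzip _).2 ⟨_, _, rfl, Or.inr (Or.inl ⟨rfl, rfl⟩)⟩)
    have hb : Relation.EqvGen R (inl b) (inr (n, a)) :=
      .rel _ _ ((hzip _).2 ⟨_, _, rfl, Or.inr (Or.inr (Or.inl ⟨rfl, rfl⟩))⟩)
    have hl : ∀ s : α, Relation.EqvGen R (inl s) (inl (τ s)) := by
      intro s
      by_cases hsa : s = a
      · rcases hab' with h | h
        · rw [hsa, h]; exact .refl _
        · rw [hsa, h]; exact ha.trans _ _ _ hb.symm
      by_cases hsb : s = b
      · rcases hab' with h | h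
        · rw [hsb, ← hab, h]; exact hb.trans _ _ _ ha.symm
        · rw [hsb, ← hab, h]; exact .refl _
      · rw [hτ s hsa hsb]; exact .refl _
    have hrt : ∀ t ∈ labels (A' ++ (cap ++ B')), Relation.EqvGen R (inl t.2) (inr t) := by
      intro t ht
      simp only [labels_append, List.mem_append, cap, labels_cons, labels_nil, List.mem_cons,
        List.not_mem_nil, or_false, or_self] at ht
      rcases ht with ht | rfl | ht
      · exact .rel _ _ ((hzip _).2 ⟨_, _, rfl, Or.inl (exists_mem_zip_indexed ht)⟩)
      · exact ha
      · exact .rel _ _ ((hzip _).2 ⟨_, _, rfl, Or.inr (Or.inr (Or.inr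
          (exists_mem_zip_indexed ht)))⟩)
    have hrt' : ∀ t ∈ labels (A' ++ ([] ++ B')), Relation.EqvGen R (inl t.2) (inr t) := by
      intro t ht
      refine hrt t ?_
      simp only [labels_append, List.nil_append, List.mem_append] at ht ⊢
      tauto
    have hrs : ∀ t, Relation.EqvGen R (inl t.2) (inr t) → Relation.EqvGen R (inr t) (σ (inr t)) :=
      fun t ht => ht.symm.trans _ _ _ (hl t.2)
    intro s hs
    rw [← relabel_append, ← relabel_append, labels_relabel, labels_relabel, List.mem_append,
      List.mem_map, List.mem_map] at hs
    rcases hs with ⟨x, -, rfl⟩ | ⟨y, hy, rfl⟩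
    · exact hl x
    · refine hrs y ?_
      rw [labels_append, List.mem_append] at hy
      exact hy.elim (hrt y) (hrt' y)

/-- Contraction that gives the joined block the label of the first point. -/
lemma HasRows.contract_left [DecidableEq α] (hC : IsCategory C) {u A B : Word α} {e : Color}
    {a b : α} (h : HasRows C u (A ++ (e, a) :: (e.inv, b) :: B)) :
    HasRows C (relabel (Function.update id b a) u) (relabel (Function.update id b a) (A ++ B)) := by
  have h1 : Function.update (id : α → α) b a a = a := by
    by_cases h : a = b
    · subst h; simp
    · simp [Function.update_of_ne h]
  exact h.contract hC (fun t _ h => Function.update_of_ne h _ _) (by simp [h1]) (Or.inl h1)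

/-- Contraction that gives the joined block the label of the second point. -/
lemma HasRows.contract_right [DecidableEq α] (hC : IsCategory C) {u A B : Word α} {e : Color}
    {a b : α} (h : HasRows C u (A ++ (e, a) :: (e.inv, b) :: B)) :
    HasRows C (relabel (Function.update id a b) u) (relabel (Function.update id a b) (A ++ B)) := by
  have h1 : Function.update (id : α → α) a b b = b := by
    by_cases h : b = a
    · subst h; simp
    · simp [Function.update_of_ne h]
  exact h.contract hC (fun t h _ => Function.update_of_ne h _ _) (by simp [h1]) (Or.inr (by simp))

lemma exists_fresh (S : List ℕ) : ∃ z, z ∉ S := by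
  obtain ⟨z, hz⟩ := Finset.exists_notMem S.toFinset
  exact ⟨z, by simpa using hz⟩

/-- Rotation amounts to adding an identity line on the left and contracting its upper point with the
leftmost upper point. -/
lemma HasRows.leftDown (hC : IsCategory C) {x : Color × ℕ} {u v : Word ℕ}
    (h : HasRows C (x :: u) v) : HasRows C u (invLetter x :: v) := by
  obtain ⟨e, s⟩ := x
  obtain ⟨z, hz⟩ := exists_fresh (labels ((e, s) :: u ++ v))
  have h1 := ((hasRows_id hC (e.inv, z)).tensor hC h (by simpa using hz)).invol hC
  have h2 : HasRows C ((e.inv, z) :: v) ([] ++ (e.inv, z) :: (e.inv.inv, s) :: u) := by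
    simpa using h1
  have h3 := (h2.contract_right hC).invol hC
  simp only [labels_append, labels_cons, List.mem_append, List.mem_cons, not_or, List.cons_append] at hz
  simpa [invLetter, relabel_update_of_notMem s hz.2.1, relabel_update_of_notMem s hz.2.2] using h3

lemma HasRows.leftUp (hC : IsCategory C) {x : Color × ℕ} {u v : Word ℕ}
    (h : HasRows C u (x :: v)) : HasRows C (invLetter x :: u) v :=
  ((h.invol hC).leftDown hC).invol hC

lemma HasRows.rightDown (hC : IsCategory C) {x : Color × ℕ} {u v : Word ℕ}
    (h : HasRows C (u ++ [x]) v) : HasRows C u (v ++ [invLetter x]) := by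
  obtain ⟨e, s⟩ := x
  obtain ⟨z, hz⟩ := exists_fresh (labels (u ++ [(e, s)] ++ v))
  have hz' := hz
  simp only [labels_append, labels_cons, List.mem_append, List.mem_cons, not_or,
    labels_nil, List.not_mem_nil, or_false] at hz
  have h1 := (h.tensor hC (hasRows_id hC (e.inv, z)) (by
    intro a ha
    simp only [labels_append, labels_cons, labels_nil, List.mem_append, List.mem_cons,
      List.not_mem_nil, or_false, or_self]
    rintro rfl
    exact hz' ha)).invol hC
  have h2 : HasRows C (v ++ [(e.inv, z)]) (u ++ (e, s) :: (e.inv, z) :: []) := by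
    simpa using h1
  have h3 := (h2.contract_left hC).invol hC
  simpa [invLetter, relabel_update_of_notMem s hz.1.1, relabel_update_of_notMem s hz.2] using h3

lemma HasRows.rotate (hC : IsCategory C) {A B : Word ℕ} (h : HasRows C [] (A ++ B)) :
    HasRows C [] (B ++ A) := by
  induction A generalizing B with
  | nil => simpa using h
  | cons x A ih =>
    have h1 : HasRows C ([] ++ [invLetter x]) (A ++ B) := h.leftUp hC
    have h2 := h1.rightDown hC
    rw [invLetter_invLetter, List.append_assoc] at h2
    simpa using ih h2

/-- All upper points can be moved to the lower row and back. -/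
lemma hasRows_iff (hC : IsCategory C) {u v : Word ℕ} :
    HasRows C u v ↔ HasRows C [] (bar u ++ v) := by
  induction u generalizing v with
  | nil => simp
  | cons x u ih =>
    have : HasRows C (x :: u) v ↔ HasRows C u (invLetter x :: v) :=
      ⟨fun h => h.leftDown hC, fun h => by simpa using h.leftUp hC⟩
    rw [this, ih]
    simp

end

section

variable {C : Set AnyColPart}

/-! ### Operations on words in a category -/

lemma HasRows.append (hC : IsCategory C) {A B : Word ℕ} (hA : HasRows C [] A)
    (hB : HasRows C [] B) (hd : ∀ a ∈ labels A, a ∉ labels B) : HasRows C [] (A ++ B) := by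
  simpa using hA.tensor hC hB (by simpa using hd)

lemma HasRows.insert (hC : IsCategory C) {A B W : Word ℕ} (h : HasRows C [] (A ++ B))
    (hW : HasRows C [] W) (hd : ∀ a ∈ labels W, a ∉ labels (A ++ B)) :
    HasRows C [] (A ++ (W ++ B)) := by
  have h1 := (h.rotate hC).append hC hW (fun a ha haW => hd a haW (by
    simp only [labels_append, List.mem_append] at ha ⊢; tauto))
  rw [List.append_assoc] at h1
  simpa using h1.rotate hC

lemma HasRows.bar (hC : IsCategory C) {A : Word ℕ} (h : HasRows C [] A) : HasRows C [] (bar A) := by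
  simpa using (hasRows_iff hC).1 (h.invol hC)

/-- Contraction in which the label `z` disappears, so that nothing is joined: this happens if the first
point is a singleton, or if the two points form a block. -/
lemma HasRows.cancel_left (hC : IsCategory C) {A B : Word ℕ} {e : Color} {z a : ℕ}
    (h : HasRows C [] (A ++ (e, z) :: (e.inv, a) :: B)) (hz : z ∉ labels (A ++ B)) :
    HasRows C [] (A ++ B) := by
  simpa only [relabel_nil, relabel_update_of_notMem a hz] using h.contract_right hC

lemma HasRows.cancel_right (hC : IsCategory C) {A B : Word ℕ} {e : Color} {z a : ℕ}
    (h : HasRows C [] (A ++ (e, a) :: (e.inv, z) :: B)) (hz : z ∉ labels (A ++ B)) :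
    HasRows C [] (A ++ B) := by
  simpa only [relabel_nil, relabel_update_of_notMem a hz] using h.contract_left hC

/-- The four-block makes it possible to triple a point: a copy of it is inserted next to the point and
contracted with it. -/
lemma HasRows.triple (hC : IsCategory C) (hf : (⟨0, 4, fourBlock⟩ : AnyColPart) ∈ C)
    {A B : Word ℕ} {e : Color} {a : ℕ} (h : HasRows C [] (A ++ (e, a) :: B)) :
    HasRows C [] (A ++ (e, a) :: (e.inv, a) :: (e, a) :: B) := by
  obtain ⟨z, hz⟩ := exists_fresh (labels (A ++ (e, a) :: B))
  have h4 : HasRows C [] [(Color.white, z), (Color.black, z), (Color.white, z), (Color.black, z)] := by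
    have : HasRows C [] _ := ⟨_, _, _, rows_ofWord _ _, hf⟩
    simpa [relabel, List.ofFn_succ] using this.map (fun _ => z) (by simp [labels, List.ofFn_succ])
  have h4' : HasRows C [] [(e.inv, z), (e, z), (e.inv, z), (e, z)] := by
    cases e
    · exact HasRows.rotate (A := [(Color.white, z)]) hC h4
    · exact h4
  have h1 : HasRows C [] ((A ++ [(e, a)]) ++ B) := by simpa using h
  have h2 := h1.insert hC h4' (by
    intro b hb
    obtain rfl : b = z := by simpa using hb
    simpa using hz)
  have h3 : HasRows C [] (A ++ (e, a) :: (e.inv, z) :: ((e, z) :: (e.inv, z) :: (e, z) :: B)) := by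
    simpa using h2
  have h5 := h3.contract_left hC
  simp only [labels_append, labels_cons, List.mem_append, List.mem_cons, not_or] at hz
  simpa [relabel_update_of_notMem a hz.1, relabel_update_of_notMem a hz.2.2] using h5

/-- The two singletons of inverse colors make it possible to isolate a point: the point is contracted
with one of them, and the other one takes its place. -/
lemma HasRows.isolate (hC : IsCategory C)
    (hs : ∀ (e : Color) (y z : ℕ), y ≠ z → HasRows C [] [(e, y), (e.inv, z)])
    {A B : Word ℕ} {e : Color} {a z : ℕ} (h : HasRows C [] (A ++ (e, a) :: B))
    (hz : z ∉ labels (A ++ (e, a) :: B)) : HasRows C [] (A ++ (e, z) :: B) := by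
  obtain ⟨y, hy⟩ := exists_fresh (z :: labels (A ++ (e, a) :: B))
  have h1 : HasRows C [] ((A ++ [(e, a)]) ++ B) := by simpa using h
  simp only [labels_append, labels_cons, List.mem_append, List.mem_cons, not_or] at hz hy
  have h2 := h1.insert hC (hs e.inv y z hy.1) (by
    intro b hb
    obtain rfl | rfl : b = y ∨ b = z := by simpa using hb
    · simp; tauto
    · simp; tauto)
  have h3 : HasRows C [] (A ++ (e, a) :: (e.inv, y) :: ((e, z) :: B)) := by simpa using h2
  refine h3.cancel_right hC ?_
  simp; tauto

/-- A singleton next to a point of inverse color can be joined to the block of this point: the point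
is tripled, and the third copy cancels the singleton. -/
lemma HasRows.attach (hC : IsCategory C) (hf : (⟨0, 4, fourBlock⟩ : AnyColPart) ∈ C)
    {A B : Word ℕ} {e : Color} {a z : ℕ} (h : HasRows C [] (A ++ (e, a) :: (e.inv, z) :: B))
    (hz : z ∉ labels (A ++ (e, a) :: B)) : HasRows C [] (A ++ (e, a) :: (e.inv, a) :: B) := by
  have h1 : HasRows C [] ((A ++ [(e, a), (e.inv, a)]) ++ (e, a) :: (e.inv, z) :: B) := by
    simpa using h.triple hC hf
  simpa using h1.cancel_right hC (by simpa using hz)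

/-! ### Words of singletons -/

/-- `Fresh w S`: the labels of `w` are distinct and not in `S`. So if `w` is part of a word whose
other labels are in `S`, then the points of `w` are singletons. -/
def Fresh (w : Word ℕ) (S : List ℕ) : Prop := (labels w).Nodup ∧ ∀ a ∈ labels w, a ∉ S

lemma exists_fresh_word (cs : List Color) (S : List ℕ) :
    ∃ w : Word ℕ, w.map Prod.fst = cs ∧ Fresh w S := by
  induction cs with
  | nil => exact ⟨[], rfl, by simp, by simp⟩
  | cons c cs ih =>
    obtain ⟨w, hw, h1, h2⟩ := ih
    obtain ⟨z, hz⟩ := exists_fresh (labels w ++ S)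
    rw [List.mem_append, not_or] at hz
    refine ⟨(c, z) :: w, by simp [hw], by simp [h1, hz.1], ?_⟩
    simpa [hz.2] using h2

lemma exists_fresh_csum (n : ℤ) (S : List ℕ) : ∃ w : Word ℕ, csum w = n ∧ Fresh w S := by
  obtain ⟨m, rfl | rfl⟩ := n.eq_nat_or_neg
  · obtain ⟨w, hw, h⟩ := exists_fresh_word (List.replicate m .white) S
    refine ⟨w, ?_, h⟩
    rw [csum_eq_of_fst (v := List.replicate m (Color.white, 0)) (by simp [hw])]
    simp [csum, Color.val]
  · obtain ⟨w, hw, h⟩ := exists_fresh_word (List.replicate m .black) S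
    refine ⟨w, ?_, h⟩
    rw [csum_eq_of_fst (v := List.replicate m (Color.black, 0)) (by simp [hw])]
    simp [csum, Color.val]

/-- A word of singletons next to its mirror image can be removed. -/
lemma HasRows.cancel_bar (hC : IsCategory C) {A I K B : Word ℕ}
    (hK : K.map Prod.fst = (TwoColored.bar I).map Prod.fst)
    (h : HasRows C [] (A ++ (I ++ (K ++ B)))) (hI : Fresh (I ++ K) (labels (A ++ B))) :
    HasRows C [] (A ++ B) := by
  induction I generalizing A K B with
  | nil =>
    obtain rfl : K = [] := by simpa using hK
    simpa using h
  | cons x I ih =>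
    rw [bar_cons, List.map_append, List.map_eq_append_iff] at hK
    obtain ⟨K', L, rfl, hK', hL⟩ := hK
    obtain ⟨y, rfl⟩ : ∃ y, L = [y] := by
      have : L.length = 1 := by simpa using congrArg List.length hL
      exact List.length_eq_one_iff.1 this
    have hy : y.1 = x.1.inv := by simpa [invLetter] using hL
    obtain ⟨hI1, hI2⟩ := hI
    simp only [labels_append, labels_cons, labels_nil, List.cons_append, List.nodup_cons,
      List.mem_append, List.mem_cons, List.not_mem_nil, or_false, List.nodup_append, not_or] at hI1 hI2
    have h1 : HasRows C [] ((A ++ [x]) ++ (y :: B)) := by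
      refine ih hK' (by simpa using h) ⟨?_, ?_⟩
      · simp only [labels_append, List.nodup_append]
        grind
      · simp only [labels_append, labels_cons, labels_nil, List.mem_append, List.mem_cons]
        grind
    have h2 : HasRows C [] (A ++ (x.1, x.2) :: (x.1.inv, y.2) :: B) := by
      rw [← hy]; simpa using h1
    refine h2.cancel_left hC ?_
    simp only [labels_append, List.mem_append]
    grind

/-- A word of color sum zero is empty or contains two adjacent points of inverse colors. -/
lemma exists_adjacent_of_csum_eq_zero {w : Word ℕ} (h0 : w ≠ []) (h : csum w = 0) :
    ∃ A e a b B, w = A ++ (e, a) :: (e.inv, b) :: B := by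
  have key : ∀ (x : Color × ℕ) (w : Word ℕ), (∃ A e a b B, x :: w = A ++ (e, a) :: (e.inv, b) :: B) ∨
      csum (x :: w) = x.1.val * (w.length + 1) := by
    intro x w
    induction w generalizing x with
    | nil => right; simp
    | cons y w ih =>
      by_cases hxy : y.1 = x.1.inv
      · exact Or.inl ⟨[], x.1, x.2, y.2, w, by rw [← hxy]; rfl⟩
      · rcases ih y with ⟨A, e, a, b, B, hw⟩ | hw
        · exact Or.inl ⟨x :: A, e, a, b, B, by rw [hw]; rfl⟩
        · right
          have : y.1 = x.1 := by
            revert hxy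
            cases y.1 <;> cases x.1 <;> simp [Color.inv]
          rw [csum_cons, hw, this, List.length_cons]
          push_cast
          ring
  cases w with
  | nil => exact absurd rfl h0
  | cons x w =>
    refine (key x w).resolve_right fun hw => ?_
    rw [h] at hw
    have hx : x.1.val ≠ 0 := by cases x.1 <;> decide
    have := mul_ne_zero hx (by positivity : (w.length + 1 : ℤ) ≠ 0)
    exact this hw.symm

/-- Words of singletons of color sum zero. -/
lemma hasRows_of_csum_eq_zero (hC : IsCategory C)
    (hs : ∀ (e : Color) (y z : ℕ), y ≠ z → HasRows C [] [(e, y), (e.inv, z)])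
    {w : Word ℕ} (hw : (labels w).Nodup) (h : csum w = 0) : HasRows C [] w := by
  induction hn : w.length using Nat.strong_induction_on generalizing w with
  | _ n ih =>
    by_cases h0 : w = []
    · rw [h0]; exact hasRows_nil hC
    obtain ⟨A, e, a, b, B, rfl⟩ := exists_adjacent_of_csum_eq_zero h0 h
    simp only [labels_append, labels_cons, List.nodup_append, List.nodup_cons, List.mem_cons] at hw
    have h1 : HasRows C [] (A ++ B) := by
      refine ih (A ++ B).length (by rw [← hn]; simp) ?_ (by simpa using h) rfl
      simp only [labels_append, List.nodup_append]
      grind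
    have h2 := h1.insert hC (hs e a b (by grind)) (by
      simp only [labels_append, labels_cons, labels_nil, List.mem_append, List.mem_cons]
      grind)
    simpa using h2

/-- Only the color sum of a word of singletons matters. -/
lemma HasRows.swap (hC : IsCategory C)
    (hs : ∀ (e : Color) (y z : ℕ), y ≠ z → HasRows C [] [(e, y), (e.inv, z)])
    {A I J B : Word ℕ} (h : HasRows C [] (A ++ (I ++ B))) (hI : Fresh I (labels (A ++ B)))
    (hJ : Fresh J (labels (A ++ B))) (hIJ : csum I = csum J) : HasRows C [] (A ++ (J ++ B)) := by
  -- If the labels of `J` are not used in `I`, the mirror image of `I` followed by `J` can be inserted.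
  have key : ∀ I J : Word ℕ, Fresh I (labels (A ++ B)) → Fresh J (labels (A ++ B) ++ labels I) →
      csum I = csum J → HasRows C [] (A ++ (I ++ B)) → HasRows C [] (A ++ (J ++ B)) := by
    intro I J hI hJ hIJ h
    obtain ⟨K, hK, hKf⟩ := exists_fresh_word ((TwoColored.bar I).map Prod.fst)
      (labels (A ++ (I ++ (J ++ B))))
    obtain ⟨hI1, hI2⟩ := hI
    obtain ⟨hJ1, hJ2⟩ := hJ
    obtain ⟨hK1, hK2⟩ := hKf
    simp only [labels_append, List.mem_append, not_or] at hI2 hJ2 hK2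
    have h0 : HasRows C [] (K ++ J) := by
      refine hasRows_of_csum_eq_zero hC hs ?_ ?_
      · simp only [labels_append, List.nodup_append]
        grind
      · rw [csum_append, csum_eq_of_fst hK, csum_bar, hIJ]
        ring
    have h1 := HasRows.insert (A := A ++ I) (B := B) hC (by simpa using h) h0 (by
      simp only [labels_append, List.mem_append]
      grind)
    refine HasRows.cancel_bar hC (I := I) (K := K) hK (by simpa using h1) ⟨?_, ?_⟩
    · simp only [labels_append, List.nodup_append]
      grind
    · simp only [labels_append, List.mem_append]
      grind
  obtain ⟨J', hJ', hJf⟩ := exists_fresh_word (J.map Prod.fst) (labels (A ++ B) ++ labels I ++ labels J)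
  have e1 : csum J' = csum J := csum_eq_of_fst hJ'
  obtain ⟨hJ1, hJ2⟩ := hJf
  obtain ⟨hI1, hI2⟩ := hI
  refine key J' J ⟨hJ1, ?_⟩ ⟨hJ.1, ?_⟩ e1 (key I J' ⟨hI1, hI2⟩ ⟨hJ1, ?_⟩ (hIJ.trans e1.symm) h)
  · grind
  · have := hJ.2
    grind
  · grind

end

section

variable {C : Set AnyColPart}

/-! ### Joining a singleton to a block across other singletons -/

/-- The category contains a pair whose legs have the colors `e` and `e.inv` and enclose singletons of
color sum `n`, followed by singletons of color sum `-n`. -/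
def HasBridge (C : Set AnyColPart) (e : Color) (n : ℤ) : Prop :=
  ∃ (I J : Word ℕ) (a : ℕ), (labels ((e, a) :: I ++ J)).Nodup ∧ csum I = n ∧ csum J = -n ∧
    HasRows C [] ((e, a) :: I ++ (e.inv, a) :: J)

/-- A singleton can be joined to the block of a point of inverse color further left, if there are
only singletons in between and these have color sum `n`. -/
def CanReach (C : Set AnyColPart) (n : ℤ) : Prop :=
  ∀ (A I B : Word ℕ) (e : Color) (a z : ℕ), Fresh I (z :: labels (A ++ (e, a) :: B)) →
    z ∉ labels (A ++ (e, a) :: B) → csum I = n →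
    HasRows C [] (A ++ (e, a) :: (I ++ (e.inv, z) :: B)) →
    HasRows C [] (A ++ (e, a) :: (I ++ (e.inv, a) :: B))

/-- Rotation by half a turn. -/
lemma HasBridge.inv (hC : IsCategory C) {e : Color} {n : ℤ} (h : HasBridge C e n) :
    HasBridge C e.inv (-n) := by
  obtain ⟨I, J, a, hd, hI, hJ, h⟩ := h
  refine ⟨J, I, a, ?_, hJ, by simpa using hI, ?_⟩
  · simp only [labels_append, labels_cons, List.cons_append, List.nodup_cons, List.nodup_append,
      List.mem_append] at hd ⊢
    grind
  · simpa using h.rotate hC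

/-- Reflection. -/
lemma HasBridge.neg (hC : IsCategory C) {e : Color} {n : ℤ} (h : HasBridge C e n) :
    HasBridge C e (-n) := by
  obtain ⟨I, J, a, hd, hI, hJ, h⟩ := h
  refine ⟨TwoColored.bar I, TwoColored.bar J, a, ?_, by simp [hI], by simp [hJ], ?_⟩
  · simpa [List.nodup_append] using hd
  · have h1 : HasRows C [] (TwoColored.bar J ++
        ((e, a) :: TwoColored.bar I ++ [(e.inv, a)])) := by
      simpa [invLetter] using h.bar hC
    simpa using h1.rotate hC

lemma exists_injective_notMem (S : List ℕ) :
    ∃ τ : ℕ → ℕ, Function.Injective τ ∧ ∀ i, τ i ∉ S := by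
  refine ⟨(· + (S.sum + 1)), fun x y h => by simpa using h, fun i hi => ?_⟩
  have := List.single_le_sum (by simp) _ hi
  dsimp only at this
  omega

lemma HasBridge.exists_fresh {e : Color} {n : ℤ} (h : HasBridge C e n) (S : List ℕ) :
    ∃ (I J : Word ℕ) (a : ℕ), Fresh ((e, a) :: I ++ J) S ∧ csum I = n ∧ csum J = -n ∧
      HasRows C [] ((e, a) :: I ++ (e.inv, a) :: J) := by
  obtain ⟨I, J, a, hd, hI, hJ, h⟩ := h
  obtain ⟨τ, hinj, hτ⟩ := exists_injective_notMem S
  refine ⟨relabel τ I, relabel τ J, τ a, ⟨?_, ?_⟩, by simpa, by simpa, ?_⟩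
  · have := hd.map hinj
    simpa using this
  · intro b hb
    have : b ∈ (labels ((e, a) :: I ++ J)).map τ := by simpa using hb
    obtain ⟨i, -, rfl⟩ := List.mem_map.1 this
    exact hτ i
  · simpa using h.map τ fun _ _ _ _ h => hinj h

variable (hC : IsCategory C) (hf : (⟨0, 4, fourBlock⟩ : AnyColPart) ∈ C)
  (hs : ∀ (e : Color) (y z : ℕ), y ≠ z → HasRows C [] [(e, y), (e.inv, z)])
include hC hf hs

lemma canReach_zero : CanReach C 0 := by
  intro A I B e a z hI hz hn h
  have h1 : HasRows C [] ((A ++ [(e, a)]) ++ (I ++ ((e.inv, z) :: B))) := by simpa using h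
  obtain ⟨hI1, hI2⟩ := hI
  simp only [labels_append, labels_cons, List.mem_append, List.mem_cons, not_or] at hI2 hz
  have h2 := h1.swap hC hs (J := []) ⟨hI1, by
    simp only [labels_append, labels_cons, labels_nil, List.mem_append, List.mem_cons]
    grind⟩ ⟨by simp, by simp⟩ hn
  have h3 : HasRows C [] (A ++ (e, a) :: (e.inv, z) :: B) := by simpa using h2
  have h4 := h3.attach hC hf (by simpa using hz)
  have h5 : HasRows C [] ((A ++ [(e, a)]) ++ ([] ++ ((e.inv, a) :: B))) := by simpa using h4
  have h6 := h5.swap hC hs (J := I) ⟨by simp, by simp⟩ ⟨hI1, by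
    simp only [labels_append, labels_cons, labels_nil, List.mem_append, List.mem_cons]
    grind⟩ hn.symm
  simpa using h6

/-- The bridge is inserted next to the singleton; its second half cancels the singletons in between
and its first half replaces them. -/
lemma canReach_of_hasBridge {n : ℤ} (hb : ∀ e, HasBridge C e n) : CanReach C n := by
  intro A I B e a z hI hz hn h
  obtain ⟨I', J, c, ⟨hf1, hf2⟩, hI', hJ, hbr⟩ :=
    (hb e.inv).exists_fresh (labels (A ++ (e, a) :: (I ++ (e.inv, z) :: B)))
  obtain ⟨hI1, hI2⟩ := hI
  simp only [labels_append, labels_cons, List.mem_append, List.mem_cons, not_or, List.cons_append,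
    List.nodup_cons, List.nodup_append] at hI2 hz hf1 hf2
  have hbr' : HasRows C [] (J ++ ((e.inv, c) :: I' ++ [(e, c)])) := by
    refine HasRows.rotate hC ?_
    simpa using hbr
  have h1 : HasRows C [] ((A ++ (e, a) :: I) ++ ((e.inv, z) :: B)) := by simpa using h
  have h2 := h1.insert hC hbr' (by
    simp only [labels_append, labels_cons, labels_nil, List.mem_append, List.mem_cons]
    grind)
  have h3 : HasRows C [] ((A ++ [(e, a)]) ++
      ((I ++ J) ++ ((e.inv, c) :: (I' ++ (e, c) :: (e.inv, z) :: B)))) := by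
    simpa using h2
  have h4 := h3.swap hC hs (J := []) ⟨by
    simp only [labels_append, List.nodup_append]
    grind, by
    simp only [labels_append, labels_cons, labels_nil, List.mem_append, List.mem_cons]
    grind⟩ ⟨by simp, by simp⟩ (by simp [hn, hJ])
  have h5 : HasRows C [] (A ++ (e, a) :: (e.inv, c) :: (I' ++ (e, c) :: (e.inv, z) :: B)) := by
    simpa using h4
  -- Now the bridge is joined to `a` on its left and to `z` on its right.
  have h6 : HasRows C [] ((A ++ [(e, a), (e.inv, a)]) ++
      (e, a) :: (e.inv, c) :: (I' ++ (e, c) :: (e.inv, z) :: B)) := by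
    simpa using h5.triple hC hf
  have hcA : c ∉ labels A := by grind
  have hcB : c ∉ labels B := by grind
  have hcI : c ∉ labels I' := by grind
  have hca : a ≠ c := by grind
  have hzc : z ≠ c := by grind
  have h7 : HasRows C [] ((A ++ (e, a) :: (e.inv, a) :: I') ++ (e, a) :: (e.inv, z) :: B) := by
    simpa [relabel_update_of_notMem, hcA, hcB, hcI, Function.update_of_ne hca,
      Function.update_of_ne hzc] using h6.contract_left hC
  have h8 := h7.attach hC hf (by
    simp only [labels_append, labels_cons, List.mem_append, List.mem_cons]
    grind)
  have h9 : HasRows C [] ((A ++ [(e, a)]) ++ (e.inv, a) :: (I' ++ (e, a) :: (e.inv, a) :: B)) := by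
    simpa using h8
  -- The legs of the bridge are isolated, and the singletons are exchanged for the original ones.
  obtain ⟨y, hy⟩ := TwoColored.exists_fresh (c :: labels (A ++ (e, a) :: (I' ++ B)))
  simp only [labels_append, labels_cons, List.mem_append, List.mem_cons, not_or] at hy
  have h10 := h9.isolate hC hs (z := y) (by
    simp only [labels_append, labels_cons, labels_nil, List.mem_append, List.mem_cons]
    grind)
  have h11 : HasRows C [] ((A ++ (e, a) :: (e.inv, y) :: I') ++ (e, a) :: (e.inv, a) :: B) := by
    simpa using h10
  have h12 := h11.isolate hC hs (z := c) (by
    simp only [labels_append, labels_cons, List.mem_append, List.mem_cons]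
    grind)
  have h13 : HasRows C [] ((A ++ [(e, a)]) ++
      (((e.inv, y) :: I' ++ [(e, c)]) ++ ((e.inv, a) :: B))) := by
    simpa using h12
  have h14 := h13.swap hC hs (J := I) ⟨by
    simp only [labels_append, labels_cons, labels_nil, List.cons_append, List.nodup_cons,
      List.nodup_append, List.mem_append, List.mem_cons]
    grind, by
    simp only [labels_append, labels_cons, labels_nil, List.mem_append, List.mem_cons]
    grind⟩ ⟨hI1, by
    simp only [labels_append, labels_cons, labels_nil, List.mem_append, List.mem_cons]
    grind⟩ (by simp [hn, hI'])
  simpa using h14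

lemma CanReach.add {n m : ℤ} (hn : CanReach C n) (hm : CanReach C m) : CanReach C (n + m) := by
  intro A I B e a z hI hz hnm h
  obtain ⟨hI1, hI2⟩ := hI
  -- The singletons in between are replaced by two stretches with two stepping stones `p`, `q`.
  obtain ⟨I₁, hn₁, hd₁, hf₁⟩ := exists_fresh_csum n (z :: labels (A ++ (e, a) :: (I ++ B)))
  obtain ⟨I₂, hn₂, hd₂, hf₂⟩ := exists_fresh_csum m (z :: labels (A ++ (e, a) :: (I ++ I₁ ++ B)))
  obtain ⟨p, hp⟩ := TwoColored.exists_fresh (z :: labels (A ++ (e, a) :: (I₁ ++ I₂ ++ B)))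
  obtain ⟨q, hq⟩ := TwoColored.exists_fresh (p :: z :: labels (A ++ (e, a) :: (I₁ ++ I₂ ++ B)))
  simp only [labels_append, labels_cons, List.mem_append, List.mem_cons, not_or]
    at hI2 hz hf₁ hf₂ hp hq
  have h1 : HasRows C [] ((A ++ [(e, a)]) ++ (I ++ ((e.inv, z) :: B))) := by simpa using h
  have h2 := h1.swap hC hs (J := I₁ ++ (e.inv, p) :: (e, q) :: I₂) ⟨hI1, by
    simp only [labels_append, labels_cons, labels_nil, List.mem_append, List.mem_cons]
    grind⟩ ⟨by
    simp only [labels_append, labels_cons, List.nodup_append, List.nodup_cons, List.mem_cons]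
    grind, by
    simp only [labels_append, labels_cons, labels_nil, List.mem_append, List.mem_cons]
    grind⟩ (by simp [hnm, hn₁, hn₂])
  have h3 := hn A I₁ ((e, q) :: (I₂ ++ (e.inv, z) :: B)) e a p ⟨hd₁, by
    simp only [labels_append, labels_cons, List.mem_append, List.mem_cons]
    grind⟩ (by
    simp only [labels_append, labels_cons, List.mem_append, List.mem_cons]
    grind) hn₁ (by simpa using h2)
  have h4 : HasRows C [] ((A ++ (e, a) :: I₁) ++ (e.inv, a) :: (e.inv.inv, q) ::
      (I₂ ++ (e.inv, z) :: B)) := by simpa using h3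
  have h5 := h4.attach hC hf (by
    simp only [labels_append, labels_cons, List.mem_append, List.mem_cons]
    grind)
  have h6 := hm (A ++ (e, a) :: (I₁ ++ [(e.inv, a)])) I₂ B e a z ⟨hd₂, by
    simp only [labels_append, labels_cons, labels_nil, List.mem_append, List.mem_cons]
    grind⟩ (by
    simp only [labels_append, labels_cons, labels_nil, List.mem_append, List.mem_cons]
    grind) hn₂ (by simpa using h5)
  have h7 : HasRows C [] ((A ++ (e, a) :: I₁) ++ (e.inv, a) :: ((e, a) ::
      (I₂ ++ (e.inv, a) :: B))) := by simpa using h6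
  have h8 := h7.isolate hC hs (z := p) (by
    simp only [labels_append, labels_cons, List.mem_append, List.mem_cons]
    grind)
  have h9 : HasRows C [] ((A ++ (e, a) :: (I₁ ++ [(e.inv, p)])) ++ (e, a) ::
      (I₂ ++ (e.inv, a) :: B)) := by simpa using h8
  have h10 := h9.isolate hC hs (z := q) (by
    simp only [labels_append, labels_cons, labels_nil, List.mem_append, List.mem_cons]
    grind)
  have h11 : HasRows C [] ((A ++ [(e, a)]) ++ ((I₁ ++ (e.inv, p) :: (e, q) :: I₂) ++
      ((e.inv, a) :: B))) := by simpa using h10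
  have h12 := h11.swap hC hs (J := I) ⟨by
    simp only [labels_append, labels_cons, List.nodup_append, List.nodup_cons, List.mem_cons]
    grind, by
    simp only [labels_append, labels_cons, labels_nil, List.mem_append, List.mem_cons]
    grind⟩ ⟨hI1, by
    simp only [labels_append, labels_cons, labels_nil, List.mem_append, List.mem_cons]
    grind⟩ (by simp [hnm, hn₁, hn₂])
  simpa using h12

/-- It suffices to have a bridge of color sum `d` with a white first leg: the others are obtained from
it by symmetry and concatenation. -/
lemma canReach_of_dvd {d n : ℤ} (hb : HasBridge C .white d) (hdn : d ∣ n) : CanReach C n := by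
  have hb' : HasBridge C .black d := by simpa [Color.inv] using (hb.neg hC).inv hC
  have hp : CanReach C d := canReach_of_hasBridge hC hf hs (by rintro (_ | _) <;> assumption)
  have hm : CanReach C (-d) := canReach_of_hasBridge hC hf hs (by
    rintro (_ | _)
    · exact hb.neg hC
    · exact hb'.neg hC)
  obtain ⟨j, rfl⟩ := hdn
  induction j using Int.induction_on with
  | zero => simpa using canReach_zero hC hf hs
  | succ j ih => rw [mul_add, mul_one]; exact ih.add hC hf hs hp
  | pred j ih => rw [mul_sub, mul_one, sub_eq_add_neg]; exact ih.add hC hf hs hm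

/-- Joining a singleton to a block across other singletons. The condition on the color sum says that
the two points have the same level modulo `d`. -/
lemma HasRows.reach {d : ℤ} (hb : HasBridge C .white d) {A I B : Word ℕ} {e e' : Color} {a z : ℕ}
    (h : HasRows C [] (A ++ (e, a) :: (I ++ (e', z) :: B)))
    (hI : Fresh I (z :: labels (A ++ (e, a) :: B))) (hz : z ∉ labels (A ++ (e, a) :: B))
    (h1 : e' = e.inv → d ∣ csum I) (h2 : e' = e → d ∣ csum I + e.val) :
    HasRows C [] (A ++ (e, a) :: (I ++ (e', a) :: B)) := by
  by_cases he : e' = e.inv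
  · subst he
    exact canReach_of_dvd hC hf hs hb (h1 rfl) A I B e a z hI hz rfl h
  obtain rfl : e' = e := by revert he; cases e <;> cases e' <;> simp [Color.inv]
  -- Two singletons are inserted, so that the second serves as a stepping stone of inverse color.
  obtain ⟨p, hp⟩ := exists_fresh (z :: labels (A ++ (e', a) :: (I ++ B)))
  obtain ⟨q, hq⟩ := exists_fresh (p :: z :: labels (A ++ (e', a) :: (I ++ B)))
  obtain ⟨hI1, hI2⟩ := hI
  simp only [labels_append, labels_cons, List.mem_append, List.mem_cons, not_or] at hI2 hz hp hq
  have g1 : HasRows C [] ((A ++ (e', a) :: I) ++ ((e', z) :: B)) := by simpa using h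
  have g2 := g1.insert hC (hs e' p q (by grind)) (by
    simp only [labels_append, labels_cons, labels_nil, List.mem_append, List.mem_cons]
    grind)
  have g3 := canReach_of_dvd hC hf hs hb (h2 rfl) A (I ++ [(e', p)]) ((e', z) :: B) e' a q ⟨by
    simp only [labels_append, labels_cons, labels_nil, List.nodup_append, List.mem_cons]
    grind, by
    simp only [labels_append, labels_cons, labels_nil, List.mem_append, List.mem_cons]
    grind⟩ (by
    simp only [labels_append, labels_cons, List.mem_append, List.mem_cons]
    grind) (by simp) (by simpa using g2)
  have g4 : HasRows C [] ((A ++ (e', a) :: (I ++ [(e', p)])) ++ (e'.inv, a) :: (e'.inv.inv, z) :: B) := by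
    simpa using g3
  have g5 := g4.attach hC hf (by
    simp only [labels_append, labels_cons, labels_nil, List.mem_append, List.mem_cons]
    grind)
  have g6 := g5.isolate hC hs (z := q) (by
    simp only [labels_append, labels_cons, labels_nil, List.mem_append, List.mem_cons]
    grind)
  have g7 : HasRows C [] ((A ++ (e', a) :: I) ++ (e', p) :: (e'.inv, q) :: ((e', a) :: B)) := by
    simpa using g6
  simpa using g7.cancel_left hC (by
    simp only [labels_append, labels_cons, List.mem_append, List.mem_cons]
    grind)

end

section

variable {α β : Type} {C : Set AnyColPart}

/-! ### Noncrossing words with the level condition -/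

/-- A word of labels is noncrossing if no two different labels interlace. -/
def NoncrossingWord (l : List α) : Prop := ∀ a b, [a, b, a, b].Sublist l → a = b

/-- Two points of the same block have the same level modulo `d`. If they have inverse colors, then
the points in between have a color sum divisible by `d`; otherwise this holds after one of the two
points is included in the sum. -/
def LevelCond (d : ℤ) (w : Word α) : Prop :=
  ∀ (A I B : Word α) (e e' : Color) (a : α), w = A ++ (e, a) :: (I ++ (e', a) :: B) →
    (e' = e.inv → d ∣ csum I) ∧ (e' = e → d ∣ csum I + e.val)

lemma LevelCond.of_relabel {d : ℤ} {w : Word α} {σ : α → β} (h : LevelCond d (relabel σ w)) :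
    LevelCond d w := by
  rintro A I B e e' a rfl
  have := h (relabel σ A) (relabel σ I) (relabel σ B) e e' (σ a) (by simp)
  simpa using this

/-- If a label occurs twice, then two occurrences of some label enclose distinct labels. -/
lemma exists_repeat {w : Word ℕ} (h : ¬ (labels w).Nodup) :
    ∃ A I B e e' a, w = A ++ (e, a) :: (I ++ (e', a) :: B) ∧ (labels I).Nodup ∧ a ∉ labels I := by
  induction w with
  | nil => simp at h
  | cons x w ih =>
    by_cases hw : (labels w).Nodup
    · have hx : x.2 ∈ labels w := by
        by_contra hx
        exact h (by simp [hw, hx])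
      obtain ⟨y, hy, hxy⟩ := List.mem_map.1 hx
      obtain ⟨I, B, rfl⟩ := List.append_of_mem hy
      simp only [labels_append, labels_cons, List.nodup_append, List.nodup_cons, List.mem_cons] at hw
      refine ⟨[], I, B, x.1, y.1, y.2, ?_, hw.1, by grind⟩
      exact congrArg (· :: (I ++ y :: B)) (Prod.ext rfl hxy.symm)
    · obtain ⟨A, I, B, e, e', a, rfl, h1, h2⟩ := ih hw
      exact ⟨x :: A, I, B, e, e', a, rfl, h1, h2⟩

lemma exists_singletons_csum (hC : IsCategory C) {k : ℤ} {W : Word ℕ} (hW : (labels W).Nodup)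
    (hk : csum W = k) (h : HasRows C [] W) {n : ℤ} (hn : k ∣ n) :
    ∃ S : Word ℕ, (labels S).Nodup ∧ csum S = n ∧ HasRows C [] S := by
  have key : ∀ j : ℕ, ∃ S : Word ℕ, (labels S).Nodup ∧ csum S = k * j ∧ HasRows C [] S := by
    intro j
    induction j with
    | zero => exact ⟨[], by simp, by simp, hasRows_nil hC⟩
    | succ j ih =>
      obtain ⟨S, hS, hSk, hSC⟩ := ih
      obtain ⟨τ, hinj, hτ⟩ := exists_injective_notMem (labels S)
      have hd : ∀ a ∈ labels S, a ∉ labels (relabel τ W) := by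
        intro a ha ha'
        rw [labels_relabel, List.mem_map] at ha'
        obtain ⟨i, -, rfl⟩ := ha'
        exact hτ i ha
      refine ⟨S ++ relabel τ W, ?_, ?_, ?_⟩
      · rw [labels_append, List.nodup_append]
        refine ⟨hS, by simpa using hW.map hinj, fun a ha b hb hab => hd a ha (hab ▸ hb)⟩
      · rw [csum_append, csum_relabel, hSk, hk]
        push_cast
        ring
      · exact hSC.append hC (by simpa using h.map τ fun _ _ _ _ h => hinj h) hd
  obtain ⟨j, rfl⟩ := hn
  obtain ⟨m, rfl | rfl⟩ := j.eq_nat_or_neg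
  · exact key m
  · obtain ⟨S, hS, hSk, hSC⟩ := key m
    exact ⟨bar S, by simpa using hS, by simp [hSk], hSC.bar hC⟩

/-- Every noncrossing word with the level condition belongs to a category that contains enough
singletons, the four-block and a bridge of color sum `d`. The proof isolates a point that is
separated from another point of its block by singletons only. -/
theorem hasRows_of_noncrossingWord (hC : IsCategory C)
    (hf : (⟨0, 4, fourBlock⟩ : AnyColPart) ∈ C)
    (hs : ∀ (e : Color) (y z : ℕ), y ≠ z → HasRows C [] [(e, y), (e.inv, z)]) {k d : ℤ}
    (hb : HasBridge C .white d) {W : Word ℕ} (hW : (labels W).Nodup) (hk : csum W = k)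
    (hWC : HasRows C [] W) {w : Word ℕ} (hw : NoncrossingWord (labels w)) (hwk : k ∣ csum w)
    (hwd : LevelCond d w) : HasRows C [] w := by
  induction hn : w.length - (labels w).toFinset.card using Nat.strong_induction_on
    generalizing w with
  | _ n ih =>
  by_cases hnd : (labels w).Nodup
  · obtain ⟨S, hS, hSk, hSC⟩ := exists_singletons_csum hC hW hk hWC hwk
    have h1 : HasRows C [] ([] ++ (S ++ [])) := by simpa using hSC
    simpa using h1.swap hC hs (J := w) ⟨hS, by simp⟩ ⟨hnd, by simp⟩ hSk
  obtain ⟨A, I, B, e, e', a, rfl, hI, haI⟩ := exists_repeat hnd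
  -- As the word is noncrossing, the points of `I` are singletons of the whole word.
  have hIA : ∀ c ∈ labels I, c ∉ labels A := by
    intro c hc hcA
    have : [c, a, c, a].Sublist (labels (A ++ (e, a) :: (I ++ (e', a) :: B))) := by
      simp only [labels_append, labels_cons]
      exact ((List.singleton_sublist.2 hcA).append (((List.singleton_sublist.2 hc).append
        ((List.nil_sublist _).cons_cons a)).cons_cons a))
    exact haI (hw _ _ this ▸ hc)
  have hIB : ∀ c ∈ labels I, c ∉ labels B := by
    intro c hc hcB
    have : [a, c, a, c].Sublist (labels (A ++ (e, a) :: (I ++ (e', a) :: B))) := by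
      simp only [labels_append, labels_cons]
      exact ((List.nil_sublist _).append (((List.singleton_sublist.2 hc).append
        ((List.singleton_sublist.2 hcB).cons_cons a)).cons_cons a))
    exact haI (hw _ _ this ▸ hc)
  obtain ⟨z, hz⟩ := exists_fresh (labels (A ++ (e, a) :: (I ++ B)))
  simp only [labels_append, labels_cons, List.mem_append, List.mem_cons, not_or] at hz
  obtain ⟨hzA, hza, hzI, hzB⟩ := hz
  -- The second of the two points is isolated.
  set w' := A ++ (e, a) :: (I ++ (e', z) :: B) with hw'
  let σ : ℕ → ℕ := Function.update id z a
  have hσ : ∀ b, b ≠ z → σ b = b := fun b hb => Function.update_of_ne hb _ _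
  have hσz : σ z = a := Function.update_self _ _ _
  have hrel : relabel σ w' = A ++ (e, a) :: (I ++ (e', a) :: B) := by
    simp only [hw', relabel_append, relabel_cons, hσz, hσ a (Ne.symm hza)]
    rw [relabel_update_of_notMem a hzA, relabel_update_of_notMem a hzB,
      relabel_update_of_notMem a hzI]
  have hcount : (labels w').count z = 1 := by
    simp [hw', List.count_eq_zero_of_not_mem, hzA, hzB, hzI, Ne.symm hza]
  have h1 : HasRows C [] w' := by
    refine ih _ ?_ (w := w') ?_ ?_ ?_ rfl
    · have hle : (labels w').toFinset.card ≤ w'.length := by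
        have := List.toFinset_card_le (labels w')
        rwa [labels, List.length_map] at this
      have hins : (labels w').toFinset =
          insert z (labels (A ++ (e, a) :: (I ++ (e', a) :: B))).toFinset := by
        ext c
        simp only [hw', labels_append, labels_cons, List.mem_toFinset, List.mem_append,
          List.mem_cons, Finset.mem_insert]
        tauto
      have hcard := congrArg Finset.card hins
      rw [Finset.card_insert_of_notMem (by simp [hzA, hza, hzI, hzB])] at hcard
      have hlen : w'.length = (A ++ (e, a) :: (I ++ (e', a) :: B)).length := by simp [hw']
      omega
    · intro p q hpq
      have h2 := hw _ _ (by simpa [← hrel] using hpq.map σ)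
      by_contra hne
      have hz2 : ¬ [z, z].Sublist (labels w') := fun h => by
        have := h.count_le z
        rw [hcount] at this
        simp at this
      have hpz : p ≠ z := by
        rintro rfl
        exact hz2 (.trans (.cons_cons _ (.cons _ (.cons_cons _ (.cons _ .slnil)))) hpq)
      have hqz : q ≠ z := by
        rintro rfl
        exact hz2 (.trans (.cons _ (.cons_cons _ (.cons _ (.cons_cons _ .slnil)))) hpq)
      rw [hσ p hpz, hσ q hqz] at h2
      exact hne h2
    · have := hwk
      rw [← hrel, csum_relabel] at this
      exact this
    · exact LevelCond.of_relabel (σ := σ) (hrel ▸ hwd)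
  obtain ⟨hc1, hc2⟩ := hwd A I B e e' a rfl
  refine h1.reach hC hf hs hb ⟨hI, ?_⟩ ?_ hc1 ?_
  · simp only [labels_append, labels_cons, List.mem_append, List.mem_cons]
    grind
  · simp [hzA, hza, hzB]
  · rintro rfl
    exact hc2 rfl

end

section

variable {α β : Type} {k l k' l' : ℕ}

/-! ### Levels -/

/-- The difference between the height before a point and its level. -/
def Color.drop : Color → ℤ
  | .white => 0
  | .black => 1

/-- The labels of a word together with the levels of the points, for the initial height `h`. The
height goes up at a white point and down at a black one; the level of a point is the smaller one of
the two adjacent heights. -/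
def levels (h : ℤ) : Word α → List (α × ℤ)
  | [] => []
  | x :: w => (x.2, h - x.1.drop) :: levels (h + x.1.val) w

/-- Points with the same label have the same level modulo `d`. -/
def SameLevel (d : ℤ) (L : List (α × ℤ)) : Prop :=
  ∀ a s t, (a, s) ∈ L → (a, t) ∈ L → d ∣ s - t

lemma levels_append (h : ℤ) (w v : Word α) :
    levels h (w ++ v) = levels h w ++ levels (h + csum w) v := by
  induction w generalizing h with
  | nil => simp [levels]
  | cons x w ih => simp [levels, ih, add_assoc]

lemma levels_add (h c : ℤ) (w : Word α) :
    levels (h + c) w = (levels h w).map fun x => (x.1, x.2 + c) := by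
  induction w generalizing h with
  | nil => rfl
  | cons x w ih =>
    simp only [levels, List.map_cons, ← ih]
    congr 2 <;> ring

lemma levels_bar (h : ℤ) (w : Word α) : levels (h + csum w) (bar w) = (levels h w).reverse := by
  induction w generalizing h with
  | nil => rfl
  | cons x w ih =>
    obtain ⟨e, a⟩ := x
    rw [bar_cons, levels_append, csum_cons, ← add_assoc, ih]
    cases e <;> simp [levels, invLetter, Color.inv, Color.drop, Color.val, sub_eq_add_neg]

lemma levels_relabel (h : ℤ) (σ : α → β) (w : Word α) :
    levels h (relabel σ w) = (levels h w).map fun x => (σ x.1, x.2) := by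
  induction w generalizing h with
  | nil => rfl
  | cons x w ih => simp [levels, ih]

lemma mem_labels_of_mem_levels {h s : ℤ} {a : α} {w : Word α} (hw : (a, s) ∈ levels h w) :
    a ∈ labels w := by
  induction w generalizing h with
  | nil => simp [levels] at hw
  | cons x w ih =>
    rcases List.mem_cons.1 hw with hw | hw
    · cases hw; simp
    · exact List.mem_cons_of_mem _ (ih hw)

lemma mem_levels_iff {h s : ℤ} {a : α} {w : Word α} :
    (a, s) ∈ levels h w ↔ ∃ A e B, w = A ++ (e, a) :: B ∧ s = h + csum A - e.drop := by
  constructor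
  · intro hw
    induction w generalizing h with
    | nil => simp [levels] at hw
    | cons x w ih =>
      rcases List.mem_cons.1 hw with hw | hw
      · cases hw
        exact ⟨[], x.1, w, rfl, by simp⟩
      · obtain ⟨A, e, B, rfl, rfl⟩ := ih hw
        exact ⟨x :: A, e, B, rfl, by rw [csum_cons]; ring⟩
  · rintro ⟨A, e, B, rfl, rfl⟩
    rw [levels_append]
    exact List.mem_append_right _ List.mem_cons_self

/-- A common shift modulo `d` of all levels does not matter. -/
lemma SameLevel.transfer {d c : ℤ} {L L' : List (α × ℤ)} (h : SameLevel d L)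
    (hL : ∀ a s, (a, s) ∈ L' → ∃ t, (a, t) ∈ L ∧ d ∣ s - t - c) : SameLevel d L' := by
  intro a s t hs ht
  obtain ⟨s', hs', h1⟩ := hL a s hs
  obtain ⟨t', ht', h2⟩ := hL a t ht
  have h3 := h a s' t' hs' ht'
  have : s - t = (s - s' - c) - (t - t' - c) + (s' - t') := by ring
  rw [this]
  exact (h1.sub h2).add h3

lemma sameLevel_levels_iff {d h : ℤ} {w : Word α} :
    SameLevel d (levels h w) ↔ LevelCond d w := by
  have key : ∀ (A I : Word α) (e e' : Color), ((e' = e.inv → d ∣ csum I) ∧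
      (e' = e → d ∣ csum I + e.val)) ↔
      d ∣ (h + csum A - e.drop) - (h + (csum A + (e.val + csum I)) - e'.drop) := by
    intro A I e e'
    have h1 : (h + csum A - e.drop) - (h + (csum A + (e.val + csum I)) - e'.drop) =
        -(csum I + (e.val + e.drop - e'.drop)) := by ring
    rw [h1, dvd_neg]
    cases e <;> cases e' <;> simp [Color.inv, Color.val, Color.drop]
  constructor
  · rintro hw A I B e e' a rfl
    refine (key A I e e').2 (hw a _ _ (mem_levels_iff.2 ⟨A, e, _, rfl, rfl⟩)
      (mem_levels_iff.2 ⟨A ++ (e, a) :: I, e', B, by simp, by simp⟩))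
  · intro hw a s t hs ht
    obtain ⟨A, e, B, rfl, rfl⟩ := mem_levels_iff.1 hs
    obtain ⟨A', e', B', hw', rfl⟩ := mem_levels_iff.1 ht
    rcases List.append_eq_append_iff.1 hw' with ⟨I, rfl, h2⟩ | ⟨I, rfl, h2⟩
    · cases I with
      | nil =>
        cases h2
        simp
      | cons x I =>
        rw [List.cons_append, List.cons.injEq] at h2
        obtain ⟨rfl, rfl⟩ := h2
        have := (key A I e e').1 (hw A I B' e e' a rfl)
        simpa using this
    · cases I with
      | nil =>
        cases h2
        simp
      | cons x I =>
        rw [List.cons_append, List.cons.injEq] at h2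
        obtain ⟨rfl, rfl⟩ := h2
        have := (key A' I e' e).1 (hw A' I B e' e a (by simp))
        rw [dvd_sub_comm]
        simpa using this

/-- If all points are moved to the lower row, then the levels do not change up to a common shift. -/
lemma levelCond_iff {d : ℤ} {u v : Word α} :
    LevelCond d (bar u ++ v) ↔ SameLevel d (levels 0 u ++ levels 0 v) := by
  rw [← sameLevel_levels_iff (h := 0 + csum u), levels_append, levels_bar]
  simp [SameLevel]

/-- Rotation of a word shifts the levels of `A` by `csum B` and those of `B` by `-csum A`, which is the
same modulo `d`. -/
lemma LevelCond.rotate {d : ℤ} {A B : Word α} (h : LevelCond d (A ++ B))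
    (hd : d ∣ csum (A ++ B)) : LevelCond d (B ++ A) := by
  rw [← sameLevel_levels_iff (h := 0), levels_append] at h ⊢
  rw [levels_add _ (csum A)] at h
  rw [levels_add _ (csum B)]
  refine h.transfer (c := csum B) ?_
  intro a s hs
  rcases List.mem_append.1 hs with hs | hs
  · refine ⟨s + csum A, List.mem_append_right _ (List.mem_map.2 ⟨_, hs, rfl⟩), ?_⟩
    have : s - (s + csum A) - csum B = -csum (A ++ B) := by rw [csum_append]; ring
    rw [this]
    exact hd.neg_right
  · obtain ⟨⟨b, t⟩, hx, h2⟩ := List.mem_map.1 hs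
    cases h2
    exact ⟨t, List.mem_append_left _ hx, by simp⟩

/-! ### The local condition in terms of words -/

lemma Rows.c_eq {p : ColPart k l} {u v : Word α} (h : Rows p u v) : p.c = csum v - csum u := by
  obtain ⟨f, -, rfl, rfl⟩ := h
  have hval : ∀ e : Color, e.val =
      ((if e = Color.white then 1 else 0 : ℕ) : ℤ) - ((if e = Color.black then 1 else 0 : ℕ) : ℤ) := by
    intro e; cases e <;> rfl
  have hsum : ∀ (n : ℕ) (g : Fin n → Color) (a : Fin n → α),
      csum (List.ofFn fun i => (g i, a i)) =
        ((Finset.univ.filter fun i => g i = Color.white).card : ℤ) -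
        ((Finset.univ.filter fun i => g i = Color.black).card : ℤ) := by
    intro n g a
    rw [csum, List.map_ofFn, List.sum_ofFn, Finset.card_filter, Finset.card_filter, Nat.cast_sum,
      Nat.cast_sum, ← Finset.sum_sub_distrib]
    exact Finset.sum_congr rfl fun i _ => hval _
  rw [hsum, hsum, ColPart.c, cWhite, cBlack]
  push_cast
  ring

/-- Two labelings of the same partition differ by a relabeling. -/
lemma Rows.exists_relabel [Nonempty β] {p : ColPart k l} {u v : Word α} {u' v' : Word β}
    (h : Rows p u v) (h' : Rows p u' v') : ∃ σ, u' = relabel σ u ∧ v' = relabel σ v := by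
  obtain ⟨f, hf, rfl, rfl⟩ := h
  obtain ⟨g, hg, rfl, rfl⟩ := h'
  have hfg : g.FactorsThrough f := fun x y hxy => by
    rw [← Setoid.ker_def (f := f), ← hf, hg] at hxy
    exact hxy
  obtain ⟨σ, rfl⟩ := (Function.factorsThrough_iff g).1 hfg
  exact ⟨σ, by simp [relabel, Function.comp_def], by simp [relabel, Function.comp_def]⟩

/-- The noncrossing property in terms of a list of all points in increasing order of their positions. -/
lemma noncrossingWord_map_iff {γ : Type} {pos : γ → ℕ} {L : List γ} (f : γ → α)
    (hL : L.Pairwise fun x y => pos x < pos y) (hmem : ∀ x, x ∈ L) :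
    NoncrossingWord (L.map f) ↔ ∀ a b c d, pos a < pos b → pos b < pos c → pos c < pos d →
      f a = f c → f b = f d → f a = f b := by
  have hinj : ∀ x y, pos x = pos y → x = y := by
    intro x y hxy
    by_contra hne
    rcases List.pairwise_iff_getElem.1 hL with h
    obtain ⟨i, hi, rfl⟩ := List.getElem_of_mem (hmem x)
    obtain ⟨j, hj, rfl⟩ := List.getElem_of_mem (hmem y)
    rcases lt_trichotomy i j with hij | rfl | hij
    · exact absurd hxy (h i j hi hj hij).ne
    · exact hne rfl
    · exact absurd hxy (h j i hj hi hij).ne'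
  constructor
  · intro h a b c d hab hbc hcd hac hbd
    have : [a, b, c, d].Sublist L := by
      have hanti : Std.Antisymm fun x y : γ => pos x ≤ pos y :=
        ⟨fun x y h1 h2 => hinj x y (le_antisymm h1 h2)⟩
      refine List.sublist_of_subperm_of_pairwise (r := fun x y => pos x ≤ pos y) ?_ ?_
        (hL.imp fun h => h.le)
      · refine List.subperm_of_subset ?_ fun x _ => hmem x
        have : [a, b, c, d].Pairwise fun x y => pos x < pos y := by
          simp; omega
        exact this.imp fun h e => h.ne (congrArg pos e)
      · simp; omega
    refine h _ _ ?_
    have h2 := this.map f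
    simp only [List.map_cons, List.map_nil, ← hac, ← hbd] at h2
    exact h2
  · intro h a b hab
    obtain ⟨M, hM, hM'⟩ := List.sublist_map_iff.1 hab
    obtain ⟨x, y, z, t, rfl⟩ : ∃ x y z t, M = [x, y, z, t] :=
      List.length_eq_four.1 (by simpa using (congrArg List.length hM').symm)
    simp only [List.map_cons, List.map_nil, List.cons.injEq, and_true] at hM'
    have hp := hL.sublist hM
    simp only [List.pairwise_cons, List.mem_cons, List.not_mem_nil, or_false, forall_eq_or_imp,
      forall_eq] at hp
    obtain ⟨rfl, rfl, h1, h2⟩ := hM'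
    exact h x y z t hp.1.1 hp.2.1.1 hp.2.2.1 h1 h2

lemma NoncrossingWord.reverse {L : List α} (h : NoncrossingWord L) : NoncrossingWord L.reverse := by
  intro a b hab
  exact (h b a (by simpa using hab.reverse)).symm

lemma NoncrossingWord.rotate {L M : List α} (h : NoncrossingWord (L ++ M)) :
    NoncrossingWord (M ++ L) := by
  intro a b hab
  obtain ⟨s, t, hst, hs, ht⟩ := List.sublist_append_iff.1 hab
  have hts := ht.append hs
  match s, hst with
  | [], hst => rw [List.nil_append] at hst; subst hst; exact h a b (by simpa using hts)
  | [_], hst => cases hst; exact (h b a hts).symm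
  | [_, _], hst => cases hst; exact h a b hts
  | [_, _, _], hst => cases hst; exact (h b a hts).symm
  | [_, _, _, _], hst => cases hst; exact h a b hts
  | _ :: _ :: _ :: _ :: _ :: _, hst => cases hst

lemma Rows.noncrossing_iff {p : ColPart k l} {u v : Word α} (h : Rows p u v) :
    p.Noncrossing ↔ NoncrossingWord (labels (bar u ++ v)) := by
  obtain ⟨f, hf, rfl, rfl⟩ := h
  -- All points in the order in which the boundary of the strip is run through.
  let L : List (Fin k ⊕ Fin l) := List.ofFn inl ++ (List.ofFn inr).reverse
  have hL : L.Pairwise fun x y => pos k l x < pos k l y := by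
    simp only [L, List.pairwise_append, List.pairwise_reverse, List.pairwise_ofFn, List.mem_ofFn,
      List.mem_reverse, pos, Sum.elim_inl, Sum.elim_inr]
    refine ⟨fun i j hij => hij, fun i j hij => ?_, ?_⟩
    · have := Fin.rev_lt_rev.2 hij
      have : j.rev.val < i.rev.val := this
      omega
    · rintro _ ⟨i, rfl⟩ _ ⟨j, rfl⟩
      simp only [Sum.elim_inl, Sum.elim_inr]
      omega
  have hmem : ∀ x, x ∈ L := by
    rintro (i | j) <;> simp [L, List.mem_ofFn]
  have hlab : labels (bar (List.ofFn fun i => (p.up i, f (inl i))) ++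
      List.ofFn fun j => (p.lo j, f (inr j))) =
      ((List.ofFn inl).map f).reverse ++ (List.ofFn inr).map f := by
    simp [labels, Function.comp_def, bar, invLetter]
  have h1 : NoncrossingWord (((List.ofFn inl).map f).reverse ++ (List.ofFn inr).map f) ↔
      NoncrossingWord (L.map f) :=
    ⟨fun h => by simpa [L] using h.rotate.reverse, fun h => .rotate (by simpa [L] using h.reverse)⟩
  rw [hlab, h1, noncrossingWord_map_iff f hL hmem, ColPart.Noncrossing, hf]
  rfl

end

section

variable {α β : Type} {k l k' l' : ℕ}

/-- The condition on the rows of a partition that describes the membership in `SLoc`. -/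
def Admissible (k d : ℤ) (u v : Word α) : Prop :=
  NoncrossingWord (labels (bar u ++ v)) ∧ k ∣ csum v - csum u ∧ LevelCond d (bar u ++ v)

/-- All upper points are rotated to the left end of the lower row. -/
lemma IsRotation.rows_unroll {p : ColPart k l} {a b : ℕ} {q : ColPart a b} {u v : Word α}
    (hpq : IsRotation p q) (hq : Rows q u v) :
    ∃ (n : ℕ) (q' : ColPart 0 n), IsRotation p q' ∧ Rows q' [] (bar u ++ v) := by
  induction u generalizing a b v with
  | nil =>
    obtain rfl : 0 = a := by simpa using hq.up_length
    exact ⟨b, q, hpq, by simpa using hq⟩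
  | cons x u ih =>
    obtain _ | a := a
    · simpa using hq.up_length
    obtain ⟨y, u', hu, hr⟩ := hq.rotLeftDown
    cases hu
    obtain ⟨n, q', h1, h2⟩ := ih (hpq.leftDown q) hr
    exact ⟨n, q', h1, by simpa using h2⟩

/-- A partition without upper points is rotated cyclically. -/
lemma IsRotation.rows_rotate {p : ColPart k l} {n : ℕ} {q : ColPart 0 n} {A B : Word α}
    (hpq : IsRotation p q) (hq : Rows q [] (A ++ B)) :
    ∃ (n : ℕ) (q' : ColPart 0 n), IsRotation p q' ∧ Rows q' [] (B ++ A) := by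
  induction A generalizing n B with
  | nil => exact ⟨n, q, hpq, by simpa using hq⟩
  | cons x A ih =>
    obtain _ | n := n
    · simpa using hq.lo_length
    obtain ⟨y, v', hv, hr⟩ := hq.rotLeftUp
    cases hv
    obtain ⟨y, u', hu, hr'⟩ := hr.rotRightDown
    obtain ⟨rfl, rfl⟩ : u' = [] ∧ y = invLetter x := by
      cases u' with
      | nil => simpa [eq_comm] using hu
      | cons z u' => simp at hu
    obtain ⟨n', q', h1, h2⟩ := ih (B := B ++ [x]) (IsRotation.rightDown _ (hpq.leftUp q))
      (by simpa using hr')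
    exact ⟨n', q', h1, by simpa using h2⟩

lemma exists_rows_of_length {n : ℕ} {v : Word α} (h : v.length = n) :
    ∃ p : ColPart 0 n, Rows p [] v := by
  subst h
  exact exists_colPart [] v

/-- The first and the last point of a partition without upper points. -/
lemma Rows.exists_ends {n : ℕ} {p : ColPart 0 (n + 2)} {v : Word α} (h : Rows p [] v) :
    ∃ x I y, v = x :: (I ++ [y]) ∧ p.lo 0 = x.1 ∧ p.lo (Fin.last (n + 1)) = y.1 ∧
      (p.blocks (inr 0) (inr (Fin.last (n + 1))) ↔ x.2 = y.2) := by
  obtain ⟨f, hf, -, rfl⟩ := h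
  refine ⟨(p.lo 0, f (inr 0)),
    List.ofFn fun i : Fin n => (p.lo i.castSucc.succ, f (inr i.castSucc.succ)),
    (p.lo (Fin.last (n + 1)), f (inr (Fin.last (n + 1)))), ?_, rfl, rfl, ?_⟩
  · rw [List.ofFn_succ, List.ofFn_succ', List.concat_eq_append]
    rfl
  · rw [hf]
    exact Iff.rfl

/-- The local condition at two points of a block that are consecutive in this block: the word is
rotated such that the points in between come first. -/
lemma levelCond_of_notMem {k' d : ℕ} {p : ColPart k l}
    (hp : (⟨k, l, p⟩ : AnyColPart) ∈ SLoc k' d) {n : ℕ} {q : ColPart 0 n}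
    (hpq : IsRotation p q) {A I B : Word ℕ} {e e' : Color} {a : ℕ}
    (hq : Rows q [] (A ++ (e, a) :: (I ++ (e', a) :: B)))
    (hnc : NoncrossingWord (labels (A ++ (e, a) :: (I ++ (e', a) :: B)))) (ha : a ∉ labels I) :
    (e' = e.inv → (d : ℤ) ∣ csum I) ∧ (e' = e → (d : ℤ) ∣ csum I + e.val) := by
  have hd : ∀ c ∈ labels I, c ∉ labels ((e', a) :: (B ++ A ++ [(e, a)])) := by
    intro c hc hcJ
    have hca : a ≠ c := fun h => ha (h ▸ hc)
    simp only [labels_append, labels_cons, labels_nil, List.mem_append, List.mem_cons,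
      List.not_mem_nil, or_false] at hcJ
    simp only [labels_append, labels_cons] at hnc
    have : c ∈ labels A ∨ c ∈ labels B := by
      rcases hcJ with h | (h | h) | h
      exacts [absurd h.symm hca, Or.inr h, Or.inl h, absurd h.symm hca]
    rcases this with h | h
    · exact hca (hnc c a ((List.singleton_sublist.2 h).append (((List.singleton_sublist.2 hc).append
        ((List.nil_sublist _).cons_cons a)).cons_cons a))).symm
    · exact hca (hnc a c ((List.nil_sublist _).append (((List.singleton_sublist.2 hc).append
        ((List.singleton_sublist.2 h).cons_cons a)).cons_cons a)))
  obtain ⟨n', q', hpq', hq'⟩ := IsRotation.rows_rotate (A := A ++ [(e, a)])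
    (B := I ++ (e', a) :: B) hpq (by simpa using hq)
  obtain ⟨p₁, hp₁⟩ := exists_rows_of_length (v := I) rfl
  obtain ⟨p₂, hp₂⟩ := exists_rows_of_length (n := (B ++ A).length + 2)
    (v := (e', a) :: ((B ++ A) ++ [(e, a)])) (by simp; omega)
  have ht := hp₁.tensor hp₂ (by simpa using hd)
  have heq := hq'.unique (q := p₁.tensor p₂) (by simpa using ht)
  have hrot : IsRotation p (p₁.tensor p₂) := by
    have key : ∀ x y : AnyColPart, x = y → IsRotation p x.2.2 → IsRotation p y.2.2 := by
      rintro x _ rfl h; exact h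
    exact key _ _ heq hpq'
  have hloc := hp.2.2 _ _ p₁ p₂ hrot
  obtain ⟨x, M, y, hv, h0, hlast, hbl⟩ := hp₂.exists_ends
  rw [List.cons.injEq] at hv
  obtain ⟨rfl, hv⟩ := hv
  obtain ⟨-, hy⟩ := List.append_inj' hv rfl
  obtain rfl : (e, a) = y := by simpa using hy
  rw [LocalCondition, h0, hlast, hp₁.c_eq] at hloc
  obtain ⟨c1, c2, c3⟩ := hloc (hbl.2 rfl)
  simp only [csum_nil, sub_zero] at c1 c2 c3
  constructor
  · rintro rfl
    exact c1 (by cases e <;> simp [Color.inv])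
  · rintro rfl
    cases e'
    · have := (c3 rfl rfl).neg_right
      simpa [Color.val, add_comm] using this
    · simpa [Color.val, sub_eq_add_neg] using c2 rfl rfl

/-- The local condition passes from consecutive points of a block to any two of its points. -/
lemma levelCond_of_mem {k' d : ℕ} {p : ColPart k l}
    (hp : (⟨k, l, p⟩ : AnyColPart) ∈ SLoc k' d) {n : ℕ} {q : ColPart 0 n}
    (hpq : IsRotation p q) {w : Word ℕ} (hq : Rows q [] w)
    (hnc : NoncrossingWord (labels w)) : LevelCond d w := by
  rintro A I B e e' a rfl
  induction hn : I.length using Nat.strong_induction_on generalizing A I B e e' with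
  | _ n ih =>
    by_cases ha : a ∈ labels I
    · -- A further point of the block splits the interval into two shorter ones.
      obtain ⟨⟨f, b⟩, hb, rfl⟩ := List.mem_map.1 ha
      obtain ⟨I₁, I₂, rfl⟩ := List.append_of_mem hb
      have h1 := ih I₁.length (by rw [← hn, List.length_append, List.length_cons]; omega)
        A I₁ (I₂ ++ (e', b) :: B) e f
        (by simpa using hq) (by simpa using hnc) rfl
      have h2 := ih I₂.length (by rw [← hn, List.length_append, List.length_cons]; omega)
        (A ++ (e, b) :: I₁) I₂ B f e'
        (by simpa using hq) (by simpa using hnc) rfl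
      rw [csum_append, csum_cons]
      have hadd := fun (x y : ℤ) (hx : (d : ℤ) ∣ x) (hy : (d : ℤ) ∣ y) => dvd_add hx hy
      cases e <;> cases f <;> cases e' <;>
        simp only [Color.inv, Color.val, reduceCtorEq, true_and, and_true,
          IsEmpty.forall_iff, forall_const] at h1 h2 ⊢ <;>
        · refine (congrArg (_ ∣ ·) ?_).mp (hadd _ _ h1 h2)
          ring
    · exact levelCond_of_notMem hp hpq hq hnc ha

/-- The level condition is invariant under rotations. -/
lemma exists_rows_of_isRotation {d : ℤ} {p : ColPart k l} {u v : Word α} (hp : Rows p u v)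
    (hd : d ∣ csum (bar u ++ v)) (hlev : LevelCond d (bar u ++ v)) {a b : ℕ} {q : ColPart a b}
    (hpq : IsRotation p q) :
    ∃ u' v' : Word α, Rows q u' v' ∧ d ∣ csum (bar u' ++ v') ∧ LevelCond d (bar u' ++ v') := by
  induction hpq with
  | refl => exact ⟨u, v, hp, hd, hlev⟩
  | leftDown q _ ih =>
    obtain ⟨u', v', h1, h2, h3⟩ := ih
    obtain ⟨x, u', rfl, h4⟩ := h1.rotLeftDown
    exact ⟨_, _, h4, by simpa using h2, by simpa using h3⟩
  | leftUp q _ ih =>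
    obtain ⟨u', v', h1, h2, h3⟩ := ih
    obtain ⟨x, v', rfl, h4⟩ := h1.rotLeftUp
    exact ⟨_, _, h4, by simpa using h2, by simpa using h3⟩
  | rightDown q _ ih =>
    obtain ⟨u', v', h1, h2, h3⟩ := ih
    obtain ⟨x, u', rfl, h4⟩ := h1.rotRightDown
    have e1 : bar (u' ++ [x]) ++ v' = [invLetter x] ++ (bar u' ++ v') := by simp
    have e2 : bar u' ++ (v' ++ [invLetter x]) = (bar u' ++ v') ++ [invLetter x] := by simp
    rw [e1] at h2 h3
    refine ⟨_, _, h4, ?_, ?_⟩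
    · rw [e2, csum_append, add_comm, ← csum_append]; exact h2
    · rw [e2]; exact h3.rotate h2
  | rightUp q _ ih =>
    obtain ⟨u', v', h1, h2, h3⟩ := ih
    obtain ⟨x, v', rfl, h4⟩ := h1.rotRightUp
    have e1 : bar (u' ++ [invLetter x]) ++ v' = [x] ++ (bar u' ++ v') := by simp
    have e2 : bar u' ++ (v' ++ [x]) = (bar u' ++ v') ++ [x] := by simp
    rw [e2] at h2 h3
    refine ⟨_, _, h4, ?_, ?_⟩
    · rw [e1, csum_append, add_comm, ← csum_append]; exact h2
    · rw [e1]; exact h3.rotate h2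

/-- Membership in `SLoc` in terms of words. -/
theorem mem_SLoc_iff {k' d : ℕ} (hkd : (d : ℤ) ∣ k') {p : ColPart k l} {u v : Word ℕ}
    (h : Rows p u v) : (⟨k, l, p⟩ : AnyColPart) ∈ SLoc k' d ↔ Admissible k' d u v := by
  constructor
  · intro hp
    have hnc := h.noncrossing_iff.1 hp.1
    refine ⟨hnc, h.c_eq ▸ hp.2.1, ?_⟩
    obtain ⟨n, q, hpq, hq⟩ := IsRotation.rows_unroll .refl h
    exact levelCond_of_mem hp hpq hq hnc
  · rintro ⟨hnc, hc, hlev⟩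
    have hc' : (k' : ℤ) ∣ csum (bar u ++ v) := by
      rw [csum_append, csum_bar]
      rwa [sub_eq_neg_add] at hc
    refine ⟨h.noncrossing_iff.2 hnc, by rwa [← h.c_eq] at hc, ?_⟩
    intro m n p₁ p₂ hrot hbl
    obtain ⟨u', w', h1, h2, h3⟩ := exists_rows_of_isRotation h (hkd.trans hc') hlev hrot
    obtain ⟨u₁, v₁, hp₁⟩ := exists_rows p₁
    obtain ⟨u₂, v₂, hp₂⟩ := exists_rows p₂
    obtain rfl : u₁ = [] := List.length_eq_zero_iff.1 hp₁.up_length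
    obtain rfl : u₂ = [] := List.length_eq_zero_iff.1 hp₂.up_length
    obtain rfl : u' = [] := List.length_eq_zero_iff.1 h1.up_length
    obtain ⟨τ, hinj, hτ⟩ := exists_injective_notMem (labels v₁)
    have hp₂' := hp₂.map τ fun _ _ _ _ h => hinj h
    have ht := hp₁.tensor hp₂' (by
      intro a ha ha'
      simp only [relabel_nil, List.nil_append, labels_relabel, List.mem_map] at ha ha'
      obtain ⟨i, -, rfl⟩ := ha'
      exact hτ i ha)
    obtain ⟨σ, -, rfl⟩ := ht.exists_relabel h1
    obtain ⟨x, I, y, hv, h0, hlast, hbl'⟩ := hp₂'.exists_ends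
    rw [hv] at h2 h3
    have hxy := hbl'.1 hbl
    obtain ⟨e, a⟩ := x
    obtain ⟨e', b⟩ := y
    obtain rfl : a = b := hxy
    -- The level condition speaks of the points between the two ends of `p₂`, the claim of `p₁`, which
    -- consists of all other points; so the divisibility of the total color sum is used.
    obtain ⟨c1, c2⟩ := LevelCond.of_relabel h3 v₁ I [] e e' a rfl
    rw [h0, hlast, hp₁.c_eq]
    simp only [bar_nil, List.nil_append, csum_relabel, csum_append, csum_cons, csum_nil, add_zero,
      sub_zero] at h2 ⊢
    cases e <;> cases e' <;>
      simp only [Color.inv, Color.val, reduceCtorEq, ne_eq, not_true_eq_false,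
        not_false_eq_true, true_and, and_true, IsEmpty.forall_iff, forall_const] at c1 c2 h2 ⊢
    · refine (congrArg (_ ∣ ·) ?_).mp (dvd_sub c2 h2)
      ring
    · refine (congrArg (_ ∣ ·) ?_).mp (dvd_sub h2 c1)
      ring
    · refine (congrArg (_ ∣ ·) ?_).mp (dvd_sub h2 c1)
      ring
    · refine (congrArg (_ ∣ ·) ?_).mp (dvd_sub h2 c2)
      ring

end

section

variable {α β : Type} {k l k' l' : ℕ}

/-! ### `SLoc` is a category of partitions -/

lemma NoncrossingWord.append {L M : List α} (hL : NoncrossingWord L) (hM : NoncrossingWord M)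
    (hd : ∀ a ∈ L, a ∉ M) : NoncrossingWord (L ++ M) := by
  intro a b hab
  obtain ⟨s, t, hst, hs, ht⟩ := List.sublist_append_iff.1 hab
  have key : ∀ c, c ∈ s → c ∈ t → a = b := fun c h1 h2 =>
    absurd (ht.subset h2) (hd c (hs.subset h1))
  match s, hst with
  | [], hst => rw [List.nil_append] at hst; subst hst; exact hM a b ht
  | [_], hst => cases hst; exact key a (by simp) (by simp)
  | [_, _], hst => cases hst; exact key a (by simp) (by simp)
  | [_, _, _], hst => cases hst; exact key b (by simp) (by simp)
  | [_, _, _, _], hst => cases hst; exact hL a b hs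
  | _ :: _ :: _ :: _ :: _ :: _, hst => cases hst

/-- Joining the blocks of two adjacent points and removing these points preserves the noncrossing
property. Up to rotation, the two points are the last ones. -/
lemma NoncrossingWord.contract [DecidableEq α] {A B : List α} {a b : α}
    (h : NoncrossingWord (A ++ a :: b :: B)) :
    NoncrossingWord ((A ++ B).map (Function.update id b a)) := by
  set τ : α → α := Function.update id b a with hτ
  have hτb : τ b = a := Function.update_self _ _ _
  have hτne : ∀ c, c ≠ b → τ c = c := fun c hc => Function.update_of_ne hc _ _
  have hτeq : ∀ x z, τ x = τ z → x ≠ z → [z].Sublist [a, b] ∧ [x].Sublist [a, b] := by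
    intro x z hxz hne
    simp only [List.singleton_sublist, List.mem_cons, List.not_mem_nil, or_false]
    by_cases hx : x = b <;> by_cases hz : z = b
    · exact absurd (hx.trans hz.symm) hne
    · rw [hx, hτb, hτne z hz] at hxz
      exact ⟨Or.inl hxz.symm, Or.inr hx⟩
    · rw [hz, hτb, hτne x hx] at hxz
      exact ⟨Or.inr hz, Or.inl hxz⟩
    · rw [hτne x hx, hτne z hz] at hxz
      exact absurd hxz hne
  have h' : NoncrossingWord ((B ++ A) ++ [a, b]) := by
    have h1 : NoncrossingWord ((A ++ [a, b]) ++ B) := by simpa using h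
    simpa using h1.rotate
  -- A point of the joined block can be replaced by one of the two last points, if necessary.
  suffices hs : NoncrossingWord ((B ++ A).map τ) by
    rw [List.map_append] at hs ⊢
    exact hs.rotate
  intro p q hpq
  obtain ⟨M, hM, hM'⟩ := List.sublist_map_iff.1 hpq
  obtain ⟨x, y, z, t, rfl⟩ : ∃ x y z t, M = [x, y, z, t] :=
    List.length_eq_four.1 (by simpa using (congrArg List.length hM').symm)
  simp only [List.map_cons, List.map_nil, List.cons.injEq, and_true] at hM'
  obtain ⟨rfl, rfl, h1, h2⟩ := hM'
  by_cases hxz : x = z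
  · subst hxz
    by_cases hyt : y = t
    · subst hyt
      exact congrArg τ (h' x y (hM.trans (List.sublist_append_left _ _)))
    · have h3 : [x, y, x].Sublist (B ++ A) :=
        .trans (.cons_cons _ (.cons_cons _ (.cons_cons _ (.cons _ .slnil)))) hM
      exact congrArg τ (h' x y (h3.append (hτeq y t h2 hyt).2))
  · have h4 := (hτeq x z h1 hxz).1
    by_cases hyt : y = t
    · subst hyt
      have h3 : [y, z, y].Sublist (B ++ A) :=
        .trans (.cons _ (.cons_cons _ (.cons_cons _ (.cons_cons _ .slnil)))) hM
      rw [h1]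
      exact (congrArg τ (h' y z (h3.append h4))).symm
    · have h5 := (hτeq y t h2 hyt).1
      have hab : τ a = τ b := by
        by_cases hab : a = b
        · rw [hab]
        · rw [hτb, hτne a hab]
      have key : ∀ c, [c].Sublist [a, b] → τ c = τ a := by
        intro c hc
        simp only [List.singleton_sublist, List.mem_cons, List.not_mem_nil, or_false] at hc
        rcases hc with rfl | rfl
        · rfl
        · exact hab.symm
      rw [h1, key z h4, h2, key t h5]

/-- Contracting the points of two mirrored stretches one after the other, starting from the middle.
The resulting relabeling `σ` identifies exactly those labels that are connected. -/
lemma NoncrossingWord.exists_contraction {S T : List α} (hST : S.length = T.length)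
    {X Y : List α} (h : NoncrossingWord (X ++ (S.reverse ++ (T ++ Y)))) :
    ∃ σ : α → α, (∀ s t, (s, t) ∈ S.zip T → σ s = σ t) ∧
      (∀ s, Relation.EqvGen (fun s t => (s, t) ∈ S.zip T) s (σ s)) ∧
      NoncrossingWord ((X ++ Y).map σ) := by
  classical
  induction hn : S.length generalizing S T X Y with
  | zero =>
    obtain rfl : S = [] := List.length_eq_zero_iff.1 hn
    obtain rfl : T = [] := List.length_eq_zero_iff.1 hST.symm
    exact ⟨id, by simp, fun s => .refl s, by simpa using h⟩
  | succ n ih =>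
    obtain _ | ⟨a, S⟩ := S
    · simp at hn
    obtain _ | ⟨b, T⟩ := T
    · simp at hST
    have h1 : NoncrossingWord ((X ++ S.reverse) ++ a :: b :: (T ++ Y)) := by simpa using h
    have h2 := h1.contract
    set τ : α → α := Function.update id b a with hτ
    have hτab : τ a = τ b := by
      by_cases hab : a = b
      · rw [hab]
      · rw [hτ, Function.update_self, Function.update_of_ne hab]; rfl
    obtain ⟨σ, c1, c2, c3⟩ := ih (T := T.map τ) (S := S.map τ) (X := X.map τ) (Y := Y.map τ)
      (by simpa using hST) (by simpa using h2) (by simpa using hn)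
    set R : α → α → Prop := fun s t => (s, t) ∈ (a :: S).zip (b :: T) with hR
    have hτR : ∀ s, Relation.EqvGen R s (τ s) := by
      intro s
      by_cases hs : s = b
      · rw [hs, hτ, Function.update_self]
        exact .symm _ _ (.rel _ _ (by simp [hR]))
      · rw [hτ, Function.update_of_ne hs]
        exact .refl _
    have hlift : ∀ s t, Relation.EqvGen (fun s t => (s, t) ∈ (S.map τ).zip (T.map τ)) s t →
        Relation.EqvGen R s t := by
      intro s t hst
      induction hst with
      | rel s t hst =>
        rw [List.zip_map] at hst
        obtain ⟨⟨s', t'⟩, hx, h3⟩ := List.mem_map.1 hst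
        cases h3
        exact ((hτR s').symm.trans _ _ _ (.rel _ _ (List.mem_cons_of_mem _ hx))).trans _ _ _ (hτR t')
      | refl s => exact .refl s
      | symm s t _ ih => exact ih.symm
      | trans s r t _ _ ih1 ih2 => exact ih1.trans _ _ _ ih2
    refine ⟨σ ∘ τ, ?_, fun s => (hτR s).trans _ _ _ (hlift _ _ (c2 (τ s))), by simpa using c3⟩
    intro s t hst
    rcases List.mem_cons.1 hst with hst | hst
    · cases hst
      exact congrArg σ hτab
    · refine c1 _ _ ?_
      rw [List.zip_map]
      exact List.mem_map.2 ⟨_, hst, rfl⟩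

lemma SameLevel.subset {d : ℤ} {L L' : List (α × ℤ)} (h : SameLevel d L) (hL : L' ⊆ L) :
    SameLevel d L' := fun a s t hs ht => h a s t (hL hs) (hL ht)

lemma SameLevel.append {d : ℤ} {L L' : List (α × ℤ)} (h : SameLevel d L) (h' : SameLevel d L')
    (hd : ∀ a s t, (a, s) ∈ L → (a, t) ∉ L') : SameLevel d (L ++ L') := by
  intro a s t hs ht
  rcases List.mem_append.1 hs with hs | hs <;> rcases List.mem_append.1 ht with ht | ht
  · exact h a s t hs ht
  · exact absurd ht (hd a s t hs)
  · exact absurd hs (hd a t s ht)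
  · exact h' a s t hs ht

/-- A choice of one level for every label. -/
lemma SameLevel.exists_level {d : ℤ} {L : List (α × ℤ)} (h : SameLevel d L) :
    ∃ lev : α → ℤ, ∀ a s, (a, s) ∈ L → d ∣ s - lev a := by
  have : ∀ a, ∃ t, ∀ s, (a, s) ∈ L → d ∣ s - t := by
    intro a
    by_cases ha : ∃ t, (a, t) ∈ L
    · obtain ⟨t, ht⟩ := ha
      exact ⟨t, fun s hs => h a s t hs ht⟩
    · exact ⟨0, fun s hs => absurd ⟨s, hs⟩ ha⟩
  choose lev hlev using this
  exact ⟨lev, hlev⟩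

lemma mem_levels_of_mem_zip {h : ℤ} {v w : Word α} (hvw : v.map Prod.fst = w.map Prod.fst)
    {s t : α} (hst : (s, t) ∈ (labels v).zip (labels w)) :
    ∃ x, (s, x) ∈ levels h v ∧ (t, x) ∈ levels h w := by
  induction v generalizing h w with
  | nil => simp at hst
  | cons y v ih =>
    obtain _ | ⟨z, w⟩ := w
    · simp at hst
    simp only [List.map_cons, List.cons.injEq] at hvw
    rcases List.mem_cons.1 hst with hst | hst
    · cases hst
      refine ⟨h - y.1.drop, List.mem_cons_self, ?_⟩
      rw [hvw.1]
      exact List.mem_cons_self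
    · obtain ⟨x, h1, h2⟩ := ih (h := h + y.1.val) hvw.2 hst
      refine ⟨x, List.mem_cons_of_mem _ h1, ?_⟩
      rw [hvw.1] at h2
      exact List.mem_cons_of_mem _ h2

section Admissible

variable {κ d : ℤ} {u v u' v' z : Word α}

lemma Admissible.invol (h : Admissible κ d u v) : Admissible κ d v u := by
  obtain ⟨h1, h2, h3⟩ := h
  refine ⟨by simpa using h1.reverse, by rwa [dvd_sub_comm], ?_⟩
  rw [levelCond_iff] at h3 ⊢
  exact h3.subset fun x hx => by simpa [or_comm] using hx

lemma Admissible.tensor (hdκ : d ∣ κ) (h : Admissible κ d u v) (h' : Admissible κ d u' v')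
    (hd : ∀ a ∈ labels (u ++ v), a ∉ labels (u' ++ v')) :
    Admissible κ d (u ++ u') (v ++ v') := by
  obtain ⟨h1, h2, h3⟩ := h
  obtain ⟨h1', h2', h3'⟩ := h'
  refine ⟨?_, ?_, ?_⟩
  · have e1 : labels (bar (u ++ u') ++ (v ++ v')) =
        labels (bar u') ++ (labels (bar u ++ v) ++ labels v') := by simp
    rw [e1]
    refine NoncrossingWord.rotate ?_
    rw [List.append_assoc]
    refine h1.append (NoncrossingWord.rotate (by simpa using h1')) ?_
    intro a ha ha'
    refine hd a (by simpa using ha) ?_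
    simpa [or_comm] using ha'
  · rw [csum_append, csum_append, add_sub_add_comm]
    exact dvd_add h2 h2'
  · rw [levelCond_iff] at h3 h3' ⊢
    have h4 : SameLevel d (levels (0 + csum u) u' ++ levels (0 + csum v) v') := by
      refine h3'.transfer (c := csum u) ?_
      intro a s hs
      rw [levels_add, levels_add] at hs
      rcases List.mem_append.1 hs with hs | hs <;> obtain ⟨⟨b, t⟩, hx, h5⟩ := List.mem_map.1 hs <;>
        cases h5
      · exact ⟨t, List.mem_append_left _ hx, by simp⟩
      · refine ⟨t, List.mem_append_right _ hx, ?_⟩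
        have : t + csum v - t - csum u = csum v - csum u := by ring
        rw [this]
        exact hdκ.trans h2
    refine (h3.append h4 ?_).subset fun x hx => ?_
    · intro a s t hs ht
      refine hd a ?_ ?_
      · rw [labels_append]
        exact List.mem_append.2 ((List.mem_append.1 hs).imp mem_labels_of_mem_levels
          mem_labels_of_mem_levels)
      · rw [labels_append]
        exact List.mem_append.2 ((List.mem_append.1 ht).imp mem_labels_of_mem_levels
          mem_labels_of_mem_levels)
    · simp only [levels_append, List.mem_append] at hx ⊢
      tauto

/-- Composition, for disjoint sets of labels: `v` and `v'` are the two copies of the middle row. -/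
lemma Admissible.comp (h : Admissible κ d u v) (h' : Admissible κ d v' z)
    (hd : ∀ a ∈ labels (u ++ v), a ∉ labels (v' ++ z)) (hvv : v.map Prod.fst = v'.map Prod.fst) :
    ∃ σ : α → α, (∀ s t, (s, t) ∈ (labels v).zip (labels v') → σ s = σ t) ∧
      (∀ s, Relation.EqvGen (fun s t => (s, t) ∈ (labels v).zip (labels v')) s (σ s)) ∧
      Admissible κ d (relabel σ u) (relabel σ z) := by
  obtain ⟨h1, h2, h3⟩ := h
  obtain ⟨h1', h2', h3'⟩ := h'
  have hlen : (labels v).length = (labels v').length := by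
    simpa [labels] using congrArg List.length hvv
  have hnc : NoncrossingWord (labels (bar u) ++
      ((labels v).reverse.reverse ++ ((labels v').reverse ++ labels z))) := by
    have := h1.append h1' (fun a ha ha' => hd a (by simpa using ha) (by simpa using ha'))
    simpa using this
  obtain ⟨σ, c1, c2, c3⟩ := hnc.exists_contraction (by simpa using hlen)
  have hzip : ∀ s t, (s, t) ∈ (labels v).reverse.zip (labels v').reverse ↔
      (s, t) ∈ (labels v).zip (labels v') := by
    intro s t
    rw [List.zip, ← List.reverse_zipWith hlen, List.mem_reverse]
  simp only [hzip] at c1 c2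
  refine ⟨σ, c1, c2, ?_, ?_, ?_⟩
  · simpa [← relabel_bar] using c3
  · have : csum (relabel σ z) - csum (relabel σ u) =
        (csum z - csum v') + (csum v - csum u) := by
      rw [csum_relabel, csum_relabel, csum_eq_of_fst hvv]
      ring
    rw [this]
    exact dvd_add h2' h2
  · rw [levelCond_iff] at h3 h3' ⊢
    obtain ⟨lev, hlev⟩ := (h3.append h3' (by
      intro a s t hs ht
      refine hd a ?_ ?_
      · rw [labels_append]
        exact List.mem_append.2 ((List.mem_append.1 hs).imp mem_labels_of_mem_levels
          mem_labels_of_mem_levels)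
      · rw [labels_append]
        exact List.mem_append.2 ((List.mem_append.1 ht).imp mem_labels_of_mem_levels
          mem_labels_of_mem_levels))).exists_level
    have hgen : ∀ s t, Relation.EqvGen (fun s t => (s, t) ∈ (labels v).zip (labels v')) s t →
        d ∣ lev s - lev t := by
      intro s t hst
      induction hst with
      | rel s t hst =>
        obtain ⟨x, hx, hx'⟩ := mem_levels_of_mem_zip (h := 0) hvv hst
        have e1 := hlev s x (by simp [hx])
        have e2 := hlev t x (by simp [hx'])
        have : lev s - lev t = (x - lev t) - (x - lev s) := by ring
        rw [this]
        exact dvd_sub e2 e1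
      | refl s => simp
      | symm s t _ ih => rwa [dvd_sub_comm]
      | trans s r t _ _ ih1 ih2 =>
        rw [← sub_add_sub_cancel]
        exact dvd_add ih1 ih2
    have key : ∀ a x, (a, x) ∈ levels 0 (relabel σ u) ++ levels 0 (relabel σ z) →
        d ∣ x - lev a := by
      intro a x hx
      rw [levels_relabel, levels_relabel, ← List.map_append] at hx
      obtain ⟨⟨s, y⟩, hy, h5⟩ := List.mem_map.1 hx
      cases h5
      rw [← sub_add_sub_cancel _ (lev s)]
      refine dvd_add (hlev s y ?_) (hgen _ _ (c2 s))
      simp only [List.mem_append] at hy ⊢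
      tauto
    intro a x y hx hy
    have : x - y = (x - lev a) - (y - lev a) := by ring
    rw [this]
    exact dvd_sub (key a x hx) (key a y hy)

end Admissible

lemma exists_disjoint_rows {u v : Word ℕ} (q : ColPart k l) :
    ∃ u' v' : Word ℕ, Rows q u' v' ∧ ∀ a ∈ labels (u ++ v), a ∉ labels (u' ++ v') := by
  obtain ⟨u', v', hq⟩ := exists_rows q
  obtain ⟨τ, hinj, hτ⟩ := exists_injective_notMem (labels (u ++ v))
  refine ⟨_, _, hq.map τ fun _ _ _ _ h => hinj h, fun a ha ha' => ?_⟩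
  rw [← relabel_append, labels_relabel, List.mem_map] at ha'
  obtain ⟨i, -, rfl⟩ := ha'
  exact hτ i ha

lemma noncrossingWord_of_forall_eq {L : List α} {c : α} (h : ∀ a ∈ L, a = c) :
    NoncrossingWord L := fun a b hab =>
  (h a (hab.subset (by simp))).trans (h b (hab.subset (by simp))).symm

lemma sameLevel_of_forall_eq {d : ℤ} {L : List (α × ℤ)} (c : ℤ) (h : ∀ x ∈ L, x.2 = c) :
    SameLevel d L := fun a s t hs ht => by
  have h1 : s = c := h _ hs
  have h2 : t = c := h _ ht
  simp [h1, h2]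

lemma admissible_id (κ d : ℤ) (e : Color) (a : α) : Admissible κ d [(e, a)] [(e, a)] := by
  refine ⟨noncrossingWord_of_forall_eq (c := a) (by simp [invLetter]), by simp, ?_⟩
  rw [levelCond_iff]
  exact sameLevel_of_forall_eq (0 - e.drop) (by simp [levels])

lemma admissible_pair (κ d : ℤ) (e : Color) (a : α) :
    Admissible κ d [] [(e, a), (e.inv, a)] := by
  refine ⟨noncrossingWord_of_forall_eq (c := a) (by simp), by simp, ?_⟩
  rw [levelCond_iff]
  refine sameLevel_of_forall_eq (0 - e.drop) ?_
  cases e <;> simp [levels, Color.inv, Color.drop, Color.val]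

theorem isCategory_SLoc {k d : ℕ} (hkd : (d : ℤ) ∣ k) : IsCategory (SLoc k d) where
  tensor_mem p q hp hq := by
    obtain ⟨u, v, hpr⟩ := exists_rows p
    obtain ⟨u', v', hqr, hd⟩ := exists_disjoint_rows (u := u) (v := v) q
    rw [mem_SLoc_iff hkd hpr] at hp
    rw [mem_SLoc_iff hkd hqr] at hq
    exact (mem_SLoc_iff hkd (hpr.tensor hqr hd)).2 (hp.tensor hkd hq hd)
  comp_mem p q hpq hp hq := by
    obtain ⟨u, v, hqr⟩ := exists_rows q
    obtain ⟨v', z, hpr, hd⟩ := exists_disjoint_rows (u := u) (v := v) p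
    rw [mem_SLoc_iff hkd hpr] at hp
    rw [mem_SLoc_iff hkd hqr] at hq
    have hfst : v.map Prod.fst = v'.map Prod.fst := by
      obtain ⟨f, -, -, rfl⟩ := hqr
      obtain ⟨g, -, rfl, -⟩ := hpr
      simp [Function.comp_def, hpq]
    obtain ⟨σ, c1, c2, hσ⟩ := hq.comp hp hd hfst
    exact (mem_SLoc_iff hkd (hqr.comp hpr hd σ c1 fun s _ => c2 s)).2 hσ
  invol_mem p hp := by
    obtain ⟨u, v, hpr⟩ := exists_rows p
    rw [mem_SLoc_iff hkd hpr] at hp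
    exact (mem_SLoc_iff hkd hpr.invol).2 hp.invol
  pair_white_black_mem := (mem_SLoc_iff hkd (rows_pair _ _ 0)).2 (admissible_pair _ _ .white 0)
  pair_black_white_mem := (mem_SLoc_iff hkd (rows_pair _ _ 0)).2 (admissible_pair _ _ .black 0)
  id_white_mem := (mem_SLoc_iff hkd (rows_idPart _ 0)).2 (admissible_id _ _ _ _)
  id_black_mem := (mem_SLoc_iff hkd (rows_idPart _ 0)).2 (admissible_id _ _ _ _)

end

section

variable {α : Type}

/-! ### The generators -/

/-- A word in which only the last label may be repeated is noncrossing. -/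
lemma noncrossingWord_of_nodup_append {L : List α} (c : α) (h : L.Nodup) :
    NoncrossingWord (L ++ [c]) := by
  intro a b hab
  obtain ⟨s, t, hst, hs, ht⟩ := List.sublist_append_iff.1 hab
  have hs' := h.sublist hs
  have ht' := ht.length_le
  match s, hst with
  | [], hst => rw [List.nil_append] at hst; subst hst; simp at ht'
  | [_], hst => cases hst; simp at ht'
  | [_, _], hst => cases hst; simp at ht'
  | [_, _, _], hst => cases hst; simp at hs'
  | [_, _, _, _], hst => cases hst; simp at hs'
  | _ :: _ :: _ :: _ :: _ :: _, hst => cases hst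

lemma noncrossingWord_of_nodup {L : List α} (h : L.Nodup) : NoncrossingWord L := by
  cases L using List.reverseRecOn with
  | nil => intro a b hab; simpa using hab.length_le
  | append_singleton L c =>
    exact noncrossingWord_of_nodup_append c (h.sublist (List.sublist_append_left _ _))

lemma levelCond_of_nodup {d : ℤ} {w : Word α} (h : (labels w).Nodup) : LevelCond d w := by
  rintro A I B e e' a rfl
  simp [List.nodup_append] at h

lemma map_fst_levels (h : ℤ) (w : Word α) : (levels h w).map Prod.fst = labels w := by
  induction w generalizing h with
  | nil => rfl
  | cons x w ih => simp [levels, ih]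

lemma sameLevel_of_nodup {d : ℤ} {L : List (α × ℤ)} (h : (L.map Prod.fst).Nodup) :
    SameLevel d L := by
  intro a s t hs ht
  have := List.inj_on_of_nodup_map h hs ht rfl
  cases this
  simp

/-- Singletons satisfy all conditions except for the one on the color sum. -/
lemma admissible_of_nodup {κ d : ℤ} {w : Word α} (h : (labels w).Nodup) (hκ : κ ∣ csum w) :
    Admissible κ d [] w :=
  ⟨noncrossingWord_of_nodup h, by simpa using hκ, levelCond_of_nodup h⟩

/-- The white singletons of the positioner. They are labeled by their positions, so that the white leg
of the pair has the label `d`. -/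
def positionerWhite (d : ℕ) : Word ℕ := (List.range d).map fun i => (Color.white, i)

/-- The black singletons of the positioner, which are labeled by their positions as well. The black leg
at the end has the label `d` of the white leg. -/
def positionerBlack (d : ℕ) : Word ℕ := (List.range d).map fun i => (Color.black, d + 1 + i)

lemma csum_positionerWhite (d : ℕ) : csum (positionerWhite d) = d := by
  simp [csum, positionerWhite, Function.comp_def, Color.val]

lemma csum_positionerBlack (d : ℕ) : csum (positionerBlack d) = -d := by
  simp [csum, positionerBlack, Function.comp_def, Color.val]

lemma labels_positioner_nodup (d : ℕ) :
    (labels (positionerWhite d ++ (Color.white, d) :: positionerBlack d)).Nodup := by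
  have h1 : labels (positionerWhite d) = List.range d := by
    simp [labels, positionerWhite, Function.comp_def]
  have h2 : labels (positionerBlack d) = (List.range d).map (d + 1 + ·) := by
    simp [labels, positionerBlack, Function.comp_def]
  simp only [labels_append, labels_cons, h1, h2, List.nodup_append, List.nodup_cons,
    List.nodup_range, List.mem_range, List.mem_map, List.mem_cons, true_and]
  refine ⟨⟨by rintro ⟨i, -, hi⟩; omega, List.nodup_range.map fun i j hij => by simpa using hij⟩, ?_⟩
  rintro a ha b (rfl | ⟨i, -, rfl⟩) <;> omega

lemma rows_positioner (d : ℕ) : Rows (positioner d) []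
    (positionerWhite d ++ (Color.white, d) :: (positionerBlack d ++ [(Color.black, d)])) := by
  have h := rows_ofWord (fun j : Fin (2 * d + 2) => if j.val ≤ d then Color.white else Color.black)
    (fun j => if j.val = 2 * d + 1 then d else j.val)
  rw [positioner]
  convert h using 1
  apply List.ext_getElem
  · simp [positionerWhite, positionerBlack]; omega
  · intro i h1 h2
    simp only [List.length_ofFn] at h2
    simp only [List.getElem_ofFn, List.getElem_append, List.getElem_cons, positionerWhite,
      positionerBlack, List.length_map, List.length_range, List.getElem_map, List.getElem_range]
    split_ifs <;> first | rfl | (exfalso; omega) | (simp; omega)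

lemma admissible_positioner {κ : ℤ} (d : ℕ) : Admissible κ d []
    (positionerWhite d ++ (Color.white, d) :: (positionerBlack d ++ [(Color.black, d)])) := by
  have hnd := labels_positioner_nodup d
  refine ⟨?_, ?_, ?_⟩
  · have := noncrossingWord_of_nodup_append d hnd
    simpa using this
  · simp [csum_positionerWhite, csum_positionerBlack, Color.val]
  · rw [levelCond_iff]
    -- The pair has the levels `d` and `0`, and all other labels occur only once.
    have h1 : SameLevel (d : ℤ) (levels 0 (positionerWhite d) ++ levels (d + 1) (positionerBlack d)) := by
      refine sameLevel_of_nodup ?_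
      rw [List.map_append, map_fst_levels, map_fst_levels, ← labels_append]
      refine hnd.sublist ?_
      simp only [labels_append, labels_cons]
      exact (List.Sublist.refl _).append (List.sublist_cons_self _ _)
    have h2 : SameLevel (d : ℤ) [(d, (d : ℤ)), (d, 0)] := by
      intro a s t hs ht
      simp only [List.mem_cons, Prod.mk.injEq, List.not_mem_nil, or_false] at hs ht
      rcases hs with ⟨-, rfl⟩ | ⟨-, rfl⟩ <;> rcases ht with ⟨-, rfl⟩ | ⟨-, rfl⟩ <;> simp
    refine (h1.append h2 ?_).subset ?_
    · intro a s t hs ht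
      obtain ⟨rfl, -⟩ : a = d ∧ (t = d ∨ t = 0) := by simpa [← and_or_left] using ht
      simp only [labels_append, labels_cons, List.nodup_append, List.nodup_cons] at hnd
      rcases List.mem_append.1 hs with hs | hs
      · exact hnd.2.2 _ (mem_labels_of_mem_levels hs) _ List.mem_cons_self rfl
      · exact hnd.2.1.1 (mem_labels_of_mem_levels hs)
    · intro x hx
      simp only [levels_append, levels, csum_positionerWhite, csum_positionerBlack, Color.drop,
        Color.val, List.mem_append, List.mem_cons, List.not_mem_nil, or_false, false_or, zero_add,
        sub_zero] at hx ⊢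
      have h3 : (d : ℤ) + 1 + -d - 1 = 0 := by ring
      rw [h3] at hx
      tauto

lemma admissible_fourBlock (κ d : ℤ) : Admissible κ d []
    [(Color.white, 0), (Color.black, 0), (Color.white, 0), (Color.black, 0)] := by
  refine ⟨noncrossingWord_of_forall_eq (c := 0) (by simp), by simp [Color.val], ?_⟩
  rw [levelCond_iff]
  exact sameLevel_of_forall_eq 0 (by simp [levels, Color.drop, Color.val])

lemma rows_fourBlock : Rows fourBlock []
    [(Color.white, 0), (Color.black, 0), (Color.white, 0), (Color.black, 0)] := by
  have h := rows_ofWord ![Color.white, .black, .white, .black] ![0, 0, 0, 0]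
  simpa [List.ofFn_succ, fourBlock] using h

lemma rows_whiteSingletonPow (k : ℕ) :
    Rows (whiteSingletonPow k) [] (List.ofFn fun j : Fin k => (Color.white, j.val)) :=
  rows_ofWord _ _

lemma labels_whiteSingletonPow_nodup (k : ℕ) :
    (labels (List.ofFn fun j : Fin k => (Color.white, j.val))).Nodup := by
  have : labels (List.ofFn fun j : Fin k => (Color.white, j.val)) = List.ofFn fun j : Fin k => j.val := by
    simp [labels, Function.comp_def]
  rw [this, List.nodup_ofFn]
  exact Fin.val_injective

lemma csum_whiteSingletonPow (k : ℕ) :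
    csum (List.ofFn fun j : Fin k => (Color.white, j.val)) = k := by
  simp [csum, Function.comp_def, Color.val]

lemma rows_singletons :
    Rows ((ColPart.singleton .white).tensor (ColPart.singleton .black)) []
      [(Color.white, 0), (Color.black, 1)] := by
  have h1 : Rows (ColPart.singleton .white) [] [(Color.white, 0)] := by
    simpa [List.ofFn_succ, ColPart.singleton] using rows_ofWord ![Color.white] ![0]
  have h2 : Rows (ColPart.singleton .black) [] [(Color.black, 0)] := by
    simpa [List.ofFn_succ, ColPart.singleton] using rows_ofWord ![Color.black] ![0]
  have h3 := h2.map (fun _ => 1) (by simp)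
  exact h1.tensor h3 (by simp)

lemma SLocGenerators_subset {k d : ℕ} (hkd : (d : ℤ) ∣ k) : SLocGenerators k d ⊆ SLoc k d := by
  rintro x (rfl | rfl | rfl | rfl)
  · refine (mem_SLoc_iff hkd (rows_whiteSingletonPow k)).2
      (admissible_of_nodup (labels_whiteSingletonPow_nodup k) ?_)
    rw [csum_whiteSingletonPow]
  · exact (mem_SLoc_iff hkd (rows_positioner d)).2 (admissible_positioner d)
  · exact (mem_SLoc_iff hkd rows_fourBlock).2 (admissible_fourBlock _ _)
  · refine (mem_SLoc_iff hkd rows_singletons).2 (admissible_of_nodup (by simp) ?_)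
    simp [Color.val]

/-! ### The generated category -/

lemma subset_generatedCategory (G : Set AnyColPart) : G ⊆ generatedCategory G :=
  fun _ hx _ hC => hC.2 hx

lemma hasRows_singletons {C : Set AnyColPart} (hC : IsCategory C)
    (h : (⟨0 + 0, 1 + 1, (ColPart.singleton .white).tensor (ColPart.singleton .black)⟩ :
      AnyColPart) ∈ C) (e : Color) (y z : ℕ) (hyz : y ≠ z) :
    HasRows C [] [(e, y), (e.inv, z)] := by
  have key : ∀ y z : ℕ, y ≠ z → HasRows C [] [(Color.white, y), (Color.black, z)] := by
    intro y z hyz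
    have h1 : HasRows C [] [(Color.white, 0), (Color.black, 1)] := ⟨_, _, _, rows_singletons, h⟩
    have := h1.map (fun n => if n = 0 then y else z) (by simp [hyz, hyz.symm])
    simpa using this
  cases e
  · exact key y z hyz
  · exact HasRows.rotate (A := [(Color.white, z)]) hC (key z y hyz.symm)

lemma hasBridge_of_positioner {C : Set AnyColPart} (hC : IsCategory C) {d : ℕ}
    (h : (⟨0, 2 * d + 2, positioner d⟩ : AnyColPart) ∈ C) : HasBridge C .white d := by
  have h1 : HasRows C [] _ := ⟨_, _, _, rows_positioner d, h⟩
  have h2 : HasBridge C .white (-d) := by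
    refine ⟨positionerBlack d, positionerWhite d, d, ?_, csum_positionerBlack d, ?_, ?_⟩
    · have := labels_positioner_nodup d
      rw [labels_append, List.nodup_append_comm] at this
      simpa using this
    · rw [csum_positionerWhite, neg_neg]
    · simpa [Color.inv] using h1.rotate hC
  simpa using h2.neg hC

theorem SLoc_eq_generatedCategory {k d : ℕ} (hkd : (d : ℤ) ∣ k) :
    SLoc k d = generatedCategory (SLocGenerators k d) := by
  apply Set.Subset.antisymm
  · rintro ⟨a, b, p⟩ hp
    obtain ⟨u, v, hr⟩ := exists_rows p
    obtain ⟨hnc, hc, hlev⟩ := (mem_SLoc_iff hkd hr).1 hp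
    have hC := isCategory_generatedCategory (SLocGenerators k d)
    have hG := subset_generatedCategory (SLocGenerators k d)
    have hk : HasRows (generatedCategory (SLocGenerators k d)) [] _ :=
      ⟨_, _, _, rows_whiteSingletonPow k, hG (by simp [SLocGenerators])⟩
    have hw := hasRows_of_noncrossingWord hC (hG (by simp [SLocGenerators]))
      (hasRows_singletons hC (hG (by simp [SLocGenerators])))
      (hasBridge_of_positioner hC (hG (by simp [SLocGenerators])))
      (labels_whiteSingletonPow_nodup k) (csum_whiteSingletonPow k) hk hnc
      (by rwa [csum_append, csum_bar, ← sub_eq_neg_add]) hlev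
    exact ((hasRows_iff hC).2 hw).mem hr
  · exact Set.sInter_subset_of_mem ⟨isCategory_SLoc hkd, SLocGenerators_subset hkd⟩

/-- The parameters can be recovered from the set: `k` from the powers of the white singleton and `d`
from the positioners. -/
lemma dvd_of_SLoc_subset {k d k' d' : ℕ} (hkd : (d : ℤ) ∣ k) (hkd' : (d' : ℤ) ∣ k')
    (h : SLoc k d ⊆ SLoc k' d') : k' ∣ k ∧ d' ∣ d := by
  have hG := (SLocGenerators_subset hkd).trans h
  constructor
  · have h1 : (⟨0, k, whiteSingletonPow k⟩ : AnyColPart) ∈ SLoc k' d' :=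
      hG (by simp [SLocGenerators])
    have h2 := ((mem_SLoc_iff hkd' (rows_whiteSingletonPow k)).1 h1).2.1
    rw [csum_whiteSingletonPow, csum_nil, sub_zero] at h2
    exact_mod_cast h2
  · have h1 : (⟨0, 2 * d + 2, positioner d⟩ : AnyColPart) ∈ SLoc k' d' :=
      hG (by simp [SLocGenerators])
    have h2 := (((mem_SLoc_iff hkd' (rows_positioner d)).1 h1).2.2 (positionerWhite d)
      (positionerBlack d) [] .white .black d rfl).1 rfl
    rw [csum_positionerBlack, dvd_neg] at h2
    exact_mod_cast h2

end

end TwoColored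

theorem mainTheorem5 :
    (∀ k d : ℕ, (k ≠ 0 → d ∣ k) →
      TwoColored.SLoc k d = TwoColored.generatedCategory (TwoColored.SLocGenerators k d)) ∧
    (∀ k d k' d' : ℕ, (k ≠ 0 → d ∣ k) → (k' ≠ 0 → d' ∣ k') →
      (k, d) ≠ (k', d') → TwoColored.SLoc k d ≠ TwoColored.SLoc k' d') := by
  have hdvd : ∀ k d : ℕ, (k ≠ 0 → d ∣ k) → (d : ℤ) ∣ k := by
    intro k d h
    by_cases hk : k = 0
    · simp [hk]
    · exact_mod_cast h hk
  refine ⟨fun k d h => TwoColored.SLoc_eq_generatedCategory (hdvd k d h), ?_⟩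
  intro k d k' d' h h' hne heq
  obtain ⟨h1, h2⟩ := TwoColored.dvd_of_SLoc_subset (hdvd k d h) (hdvd k' d' h') heq.subset
  obtain ⟨h3, h4⟩ := TwoColored.dvd_of_SLoc_subset (hdvd k' d' h') (hdvd k d h) heq.superset
  exact hne (Prod.ext (Nat.dvd_antisymm h3 h1) (Nat.dvd_antisymm h4 h2))
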